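/- **Theorem 2.5.** Let $k\ge 1$ be an integer and let $p=-i\,d/dx$ in $L^2(\mathbb R)$. Let $x^n$ denote multiplication by $x^n$, with $D(p^2)=\{u\in L^2(\mathbb R): u',u''\in L^2(\mathbb R)\}$ (weak derivatives) and $D(x^{n})=\{u\in L^2(\mathbb R): x^{n}u\in L^2(\mathbb R)\}$. Put $$P=\{(s,t)\in\mathbb R^2:\ 0<(2k-1)t+s<\pi,\ \ 0<(2k+3)t+s<\pi\}.$$ For $\beta\in\mathbb C\setminus\{0\}$ and $\theta\in\mathbb C$ let $$H(\beta,\theta)=e^{-2\theta}p^2+e^{2\theta}x^2+\beta e^{(2k+1)\theta}x^{2k+1}$$ be the operator sum in $L^2(\mathbb R)$. Then on the set of all $(\beta,\theta)$ such that $(\arg\beta,\operatorname{Im}\theta)\in P$ for some determination of $\arg\beta$, the family $H(\beta,\theta)$ is a holomorphic family of type A of closed operators with common domain $D(p^2)\cap D(x^{2k+1})$. That is, this set is open and connected; each $H(\beta,\theta)$ in it is closed with nonempty resolvent set and has domain $D(p^2)\cap D(x^{2k+1})$; and $(\beta,\theta)\mapsto H(\beta,\theta)u$ is holomorphic for every $u\in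 D(p^2)\cap D(x^{2k+1})$. Moreover, let $\beta\neq0$ and $\theta$ satisfy $(s,t)\in P$, where $t=\operatorname{Im}\theta$ and $s$ is a determination of $\arg\beta$, and let $\Pi$ be the closed half-plane $$\Pi=\{re^{i\tau}:\ r\ge 0,\ -\pi+s+(2k+1)t\le\tau\le s+(2k+1)t\}.$$ Then: 1. all resolvents of $H(\beta,\theta)$ are compact; 2. the numerical range $\{\langle u,H(\beta,\theta)u\rangle: u\in D(H(\beta,\theta)),\ \|u\|=1\}$ is contained in $\Pi$; 3. the spectrum of $H(\beta,\theta)$ is discrete (it consists of isolated eigenvalues of finite algebraic multiplicity) and is contained in $\Pi$; 4. for every $z\notin\Pi$, $\|(z-H(\beta,\theta))^{-1}\|\le 1/\operatorname{dist}(z,\Pi)$. -/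

import Mathlib

open MeasureTheory Filter Topology
open scoped ContDiff

noncomputable section

namespace OddAnharmonic

/-! ### Unbounded operators: resolvents, spectrum, numerical range -/

section Operators

variable {E : Type*} [NormedAddCommGroup E] [InnerProductSpace ℂ E]

/-- `R` is the resolvent `(z - T)⁻¹`: an everywhere defined bounded two-sided inverse
of `z - T : D(T) → E`. -/
def IsResolventAt (T : E →ₗ.[ℂ] E) (z : ℂ) (R : E →L[ℂ] E) : Prop :=
  (∀ u : T.domain, R (z • (u : E) - T u) = u) ∧
    ∀ f : E, ∃ h : R f ∈ T.domain, z • R f - T ⟨R f, h⟩ = f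

/-- The resolvent set of `T`. -/
def opResolventSet (T : E →ₗ.[ℂ] E) : Set ℂ := {z | ∃ R : E →L[ℂ] E, IsResolventAt T z R}

/-- The spectrum of `T`. -/
def opSpectrum (T : E →ₗ.[ℂ] E) : Set ℂ := (opResolventSet T)ᶜ

/-- `T` has compact resolvents: the resolvent set is nonempty and every resolvent is a compact
operator. -/
def HasCompactResolvents (T : E →ₗ.[ℂ] E) : Prop :=
  (opResolventSet T).Nonempty ∧
    ∀ (z : ℂ) (R : E →L[ℂ] E), IsResolventAt T z R → IsCompactOperator R

/-- The numerical range `{⟨u, T u⟩ : u ∈ D(T), ‖u‖ = 1}`. -/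
def opNumericalRange (T : E →ₗ.[ℂ] E) : Set ℂ :=
  {w | ∃ u : T.domain, ‖(u : E)‖ = 1 ∧ w = inner ℂ (u : E) (T u)}

/-- `λ` is an eigenvalue of `T`. -/
def IsOpEigenvalue (T : E →ₗ.[ℂ] E) (l : ℂ) : Prop :=
  ∃ u : T.domain, (u : E) ≠ 0 ∧ T u = l • (u : E)

/-- The kernel of `(T - λ)ⁿ`, on its natural domain `D(Tⁿ)`. -/
def kerPow (T : E →ₗ.[ℂ] E) (l : ℂ) : ℕ → Submodule ℂ E
  | 0 => ⊥
  | n + 1 => ((kerPow T l n).comap (T.toFun - l • T.domain.subtype)).map T.domain.subtype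

/-- The algebraic (generalized) eigenspace `⋃ₙ ker (T - λ)ⁿ`. -/
def algEigenspace (T : E →ₗ.[ℂ] E) (l : ℂ) : Submodule ℂ E := ⨆ n, kerPow T l n

/-- The spectrum of `T` is discrete: it consists of isolated eigenvalues of finite algebraic
multiplicity. -/
def HasDiscreteSpectrum (T : E →ₗ.[ℂ] E) : Prop :=
  ∀ l ∈ opSpectrum T, (∀ᶠ w in 𝓝[≠] l, w ∉ opSpectrum T) ∧ IsOpEigenvalue T l ∧
    FiniteDimensional ℂ (algEigenspace T l)

/-- Holomorphic families of type A of closed operators: on a domain `U` of the parameter space,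
every `T q` is closed with nonempty resolvent set, the operator domain `D(T q) = D` does not
depend on `q`, and `q ↦ T q u` is holomorphic on `U` for every `u ∈ D`. -/
structure IsHolomorphicTypeA {P : Type*} [NormedAddCommGroup P] [NormedSpace ℂ P]
    (U : Set P) (D : Submodule ℂ E) (T : P → E →ₗ.[ℂ] E) : Prop where
  isOpen : IsOpen U
  isConnected : IsConnected U
  closed : ∀ q ∈ U, (T q).IsClosed
  resolventSet_nonempty : ∀ q ∈ U, (opResolventSet (T q)).Nonempty
  domain_eq : ∀ q ∈ U, (T q).domain = D
  holomorphic : ∀ u ∈ D, ∃ f : P → E, DifferentiableOn ℂ f U ∧ ∀ q ∈ U, (u, f q) ∈ (T q).graph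

end Operators

/-! ### The operators `p`, `p²` and multiplication by `xⁿ` in `L²(ℝ)` -/

/-- The Hilbert space `L²(ℝ)` of complex-valued functions. -/
abbrev L2 : Type := Lp ℂ 2 (volume : Measure ℝ)

/-- `v` is the weak (distributional) derivative of `u`. -/
def IsWeakDeriv (u v : L2) : Prop :=
  ∀ φ : ℝ → ℝ, ContDiff ℝ ∞ φ → HasCompactSupport φ →
    ∫ x, deriv φ x • u x = -∫ x, φ x • v x

theorem integrable_test_smul (u : L2) {φ : ℝ → ℝ} (hφ : Continuous φ)
    (hc : HasCompactSupport φ) : Integrable (fun x => φ x • u x) volume :=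
  ((Lp.memLp u).locallyIntegrable (by norm_num)).integrable_smul_left_of_hasCompactSupport hφ hc

theorem IsWeakDeriv.unique {u v w : L2} (hv : IsWeakDeriv u v) (hw : IsWeakDeriv u w) :
    v = w := by
  apply Lp.ext
  apply ae_eq_of_integral_contDiff_smul_eq
    ((Lp.memLp v).locallyIntegrable (by norm_num)) ((Lp.memLp w).locallyIntegrable (by norm_num))
  intro g hg hgc
  exact neg_injective ((hv g hg hgc).symm.trans (hw g hg hgc))

theorem IsWeakDeriv.add {u u' v v' : L2} (h : IsWeakDeriv u v) (h' : IsWeakDeriv u' v') :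
    IsWeakDeriv (u + u') (v + v') := by
  intro φ hφ hc
  have hd : Continuous (deriv φ) := hφ.continuous_deriv (by simp)
  have e1 : ∫ x, deriv φ x • (u + u' : L2) x = ∫ x, (deriv φ x • u x + deriv φ x • u' x) := by
    apply integral_congr_ae
    filter_upwards [Lp.coeFn_add u u'] with x hx
    rw [hx, Pi.add_apply, smul_add]
  have e2 : ∫ x, φ x • (v + v' : L2) x = ∫ x, (φ x • v x + φ x • v' x) := by
    apply integral_congr_ae
    filter_upwards [Lp.coeFn_add v v'] with x hx
    rw [hx, Pi.add_apply, smul_add]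
  rw [e1, e2, integral_add (integrable_test_smul u hd hc.deriv)
    (integrable_test_smul u' hd hc.deriv), integral_add
    (integrable_test_smul v hφ.continuous hc) (integrable_test_smul v' hφ.continuous hc),
    h φ hφ hc, h' φ hφ hc]
  ring

theorem IsWeakDeriv.smul {u v : L2} (c : ℂ) (h : IsWeakDeriv u v) :
    IsWeakDeriv (c • u) (c • v) := by
  intro φ hφ hc
  have e1 : ∫ x, deriv φ x • (c • u : L2) x = ∫ x, c • (deriv φ x • u x) := by
    apply integral_congr_ae
    filter_upwards [Lp.coeFn_smul c u] with x hx
    rw [hx, Pi.smul_apply, smul_comm]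
  have e2 : ∫ x, φ x • (c • v : L2) x = ∫ x, c • (φ x • v x) := by
    apply integral_congr_ae
    filter_upwards [Lp.coeFn_smul c v] with x hx
    rw [hx, Pi.smul_apply, smul_comm]
  rw [e1, e2, integral_smul, integral_smul, h φ hφ hc, smul_neg]

theorem IsWeakDeriv.zero : IsWeakDeriv 0 0 := by
  intro φ _ _
  have e1 : ∫ x, deriv φ x • (0 : L2) x = ∫ _ : ℝ, (0 : ℂ) := by
    apply integral_congr_ae
    filter_upwards [Lp.coeFn_zero ℂ 2 (volume : Measure ℝ)] with x hx
    simp only [hx, Pi.zero_apply, smul_zero]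
  have e2 : ∫ x, φ x • (0 : L2) x = ∫ _ : ℝ, (0 : ℂ) := by
    apply integral_congr_ae
    filter_upwards [Lp.coeFn_zero ℂ 2 (volume : Measure ℝ)] with x hx
    simp only [hx, Pi.zero_apply, smul_zero]
  rw [e1, e2]
  simp

/-- The momentum operator `p = -i d/dx` in `L²(ℝ)`, on the functions in `L²(ℝ)` whose weak
derivative is in `L²(ℝ)`. -/
def pOp : L2 →ₗ.[ℂ] L2 where
  domain :=
    { carrier := {u | ∃ v, IsWeakDeriv u v}
      add_mem' := by rintro u u' ⟨v, hv⟩ ⟨v', hv'⟩; exact ⟨v + v', hv.add hv'⟩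
      zero_mem' := ⟨0, IsWeakDeriv.zero⟩
      smul_mem' := by rintro c u ⟨v, hv⟩; exact ⟨c • v, hv.smul c⟩ }
  toFun :=
    { toFun := fun u => (-Complex.I) • u.2.choose
      map_add' := by
        intro u u'
        rw [← smul_add]
        congr 1
        exact (u + u').2.choose_spec.unique (u.2.choose_spec.add u'.2.choose_spec)
      map_smul' := by
        intro c u
        rw [RingHom.id_apply, smul_comm c]
        congr 1
        exact (c • u).2.choose_spec.unique (u.2.choose_spec.smul c) }

/-- The composition `p² = p ∘ p`, with domain `D(p²) = {u ∈ D(p) : p u ∈ D(p)}`. -/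
def pSqOp : L2 →ₗ.[ℂ] L2 :=
  pOp.comp (pOp.domRestrict ((pOp.domain.comap pOp.toFun).map pOp.domain.subtype)) (by
    rintro ⟨x, hx, hx'⟩
    obtain ⟨y, hy, rfl⟩ := hx
    exact hy)

/-- The operator of multiplication by `xⁿ` in `L²(ℝ)`, on its maximal domain
`D(xⁿ) = {u ∈ L²(ℝ) : xⁿ u ∈ L²(ℝ)}`. -/
def xPowOp (n : ℕ) : L2 →ₗ.[ℂ] L2 where
  domain :=
    { carrier := {u | MemLp (fun x : ℝ => (x : ℂ) ^ n * u x) 2 volume}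
      add_mem' := by
        intro u u' hu hu'
        refine (MemLp.add hu hu').ae_eq ?_
        filter_upwards [Lp.coeFn_add u u'] with x hx
        simp only [hx, Pi.add_apply, mul_add]
      zero_mem' := by
        refine (MemLp.zero (ε := ℂ)).ae_eq ?_
        filter_upwards [Lp.coeFn_zero ℂ 2 (volume : Measure ℝ)] with x hx
        simp only [hx, Pi.zero_apply, mul_zero]
      smul_mem' := by
        intro c u hu
        refine (MemLp.const_smul hu c).ae_eq ?_
        filter_upwards [Lp.coeFn_smul c u] with x hx
        simp only [Submodule.coe_smul, hx, Pi.smul_apply, smul_eq_mul, mul_left_comm] }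
  toFun :=
    { toFun := fun u => MemLp.toLp _ u.2
      map_add' := by
        intro u u'
        rw [← MemLp.toLp_add]
        apply MemLp.toLp_congr
        filter_upwards [Lp.coeFn_add (u : L2) u'] with x hx
        simp only [Submodule.coe_add, hx, Pi.add_apply, mul_add]
      map_smul' := by
        intro c u
        rw [RingHom.id_apply, ← MemLp.toLp_const_smul]
        apply MemLp.toLp_congr
        filter_upwards [Lp.coeFn_smul c (u : L2)] with x hx
        simp only [Submodule.coe_smul, hx, Pi.smul_apply, smul_eq_mul, mul_left_comm] }

/-! ### The dilated odd anharmonic oscillator -/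

/-- `H(β,θ) = e^{-2θ} p² + e^{2θ} x² + β e^{(2k+1)θ} x^{2k+1}`, as an operator sum (that is, on the
intersection of the domains of the summands). -/
def dilatedH (k : ℕ) (β θ : ℂ) : L2 →ₗ.[ℂ] L2 :=
  Complex.exp (-2 * θ) • pSqOp + Complex.exp (2 * θ) • xPowOp 2
    + (β * Complex.exp ((2 * (k : ℂ) + 1) * θ)) • xPowOp (2 * k + 1)

/-- The space `D(p²) ∩ D(x^{2k+1})`. -/
def domH (k : ℕ) : Submodule ℂ L2 := pSqOp.domain ⊓ (xPowOp (2 * k + 1)).domain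

/-- The parallelogram `P` of the `(s,t)`-plane. -/
def parallelogram (k : ℕ) : Set (ℝ × ℝ) :=
  {q | 0 < (2 * (k : ℝ) - 1) * q.2 + q.1 ∧ (2 * (k : ℝ) - 1) * q.2 + q.1 < Real.pi ∧
    0 < (2 * (k : ℝ) + 3) * q.2 + q.1 ∧ (2 * (k : ℝ) + 3) * q.2 + q.1 < Real.pi}

/-- `s` is a determination of `arg β`, for `β ≠ 0`. -/
def IsArg (β : ℂ) (s : ℝ) : Prop := β ≠ 0 ∧ β = (‖β‖ : ℂ) * Complex.exp ((s : ℂ) * Complex.I)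

/-- The set of all `(β,θ)` such that `(arg β, Im θ) ∈ P` for some determination of `arg β`. Since
`(s, t) ∈ P` confines `s`, for given `t`, to an open interval of length at most `π`, this
determination is unique, and `paramDomain k` is a faithful copy of the set of all `(β,θ)` with `β`
on the Riemann surface of the logarithm and `(arg β, Im θ) ∈ P`. -/
def paramDomain (k : ℕ) : Set (ℂ × ℂ) :=
  {q | ∃ s : ℝ, IsArg q.1 s ∧ (s, q.2.im) ∈ parallelogram k}

/-- The closed half-plane `-π + a ≤ arg z ≤ a` (with `0` included). -/
def argHalfPlane (a : ℝ) : Set ℂ :=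
  {z | ∃ r τ : ℝ, 0 ≤ r ∧ -Real.pi + a ≤ τ ∧ τ ≤ a ∧
    z = (r : ℂ) * Complex.exp ((τ : ℂ) * Complex.I)}

/-- The half-plane `Π = {z : -π + s + (2k+1)t ≤ arg z ≤ s + (2k+1)t}`. -/
def halfPlanePi (k : ℕ) (s t : ℝ) : Set ℂ := argHalfPlane (s + (2 * (k : ℝ) + 1) * t)

end OddAnharmonic

end

open OddAnharmonic

/-! Put $\alpha=s+(2k+1)t$ and multiply $H$ by the unimodular $\zeta=e^{i(\pi/2-\alpha)}$, which
turns $\Pi$ into the right half-plane. The coefficient of $x^{2k+1}$ becomes $i\gamma$ with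
$\gamma>0$, and those of $p^2$ and $x^2$ become $a$ and $b$, whose real parts are positive multiples
of $\sin((2k+3)t+s)$ and $\sin((2k-1)t+s)$. The inequalities defining $P$ say exactly that both are
positive. For $z\notin\Pi$ put $l=-\zeta z$; inverting $z-H$ means solving $Lu=-au''+(l+bx^2+i\gamma
x^n)u=f$ with $\operatorname{Re}a,\operatorname{Re}b,\operatorname{Re}l>0$. The odd term is purely
imaginary, so it drops out of $\operatorname{Re}\langle u,Lu\rangle$.

Three facts about $L$ on test functions carry the proof. The energy estimate gives
$\|u\|\le\|Lu\|/\operatorname{Re}l$ and bounds $u'$ and $xu$. The elliptic estimate bounds $u''$ and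
$x^nu$ separately by $Lu$ (`norm_sq_schrodinger_ge`), which identifies the domain. The range is
dense: a vector orthogonal to it is a square-integrable weak solution of the adjoint equation, and a
Caccioppoli inequality with growing cut-offs makes it vanish; the same argument gives uniqueness.
Hence every $f$ is reached by a limit of test functions, in $D(p^2)\cap D(x^n)$, and the solution
operator has norm at most $1/\operatorname{Re}l$.

Control of $u'$ and $xu$ makes that operator a norm limit of finite-rank ones, so it is compact;
Riesz theory then gives discreteness. The numerical range is read off from the resolvent bounds as
$l\to\infty$. The parameter set is the image of a convex open set under $\exp\times\mathrm{id}$. -/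

open scoped ComplexConjugate

namespace OddAnharmonic

/-! ### Unbounded operators with a compact resolvent -/

section Abstract

variable {E : Type*} [NormedAddCommGroup E] [InnerProductSpace ℂ E]

/-- The graph is cut out by the continuous equation $R(zu-w)=u$. -/
theorem IsResolventAt.isClosed {T : E →ₗ.[ℂ] E} {z : ℂ} {R : E →L[ℂ] E}
    (h : IsResolventAt T z R) : T.IsClosed := by
  have hg : (T.graph : Set (E × E)) = {q | R (z • q.1 - q.2) = q.1} := by
    ext ⟨u, w⟩
    simp only [SetLike.mem_coe, LinearPMap.mem_graph_iff, Set.mem_ofPred_eq]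
    constructor
    · rintro ⟨y, rfl, rfl⟩
      exact h.1 y
    · intro hu
      obtain ⟨hd, he⟩ := h.2 (z • u - w)
      refine ⟨⟨_, hd⟩, hu, ?_⟩
      have h1 : z • u - T ⟨_, hd⟩ = z • u - w := by
        refine Eq.trans ?_ he
        exact congrArg (fun y => z • y - T ⟨_, hd⟩) hu.symm
      exact sub_right_injective h1
  rw [LinearPMap.IsClosed, hg]
  exact isClosed_eq (by fun_prop) (by fun_prop)

theorem IsResolventAt.smul_apply_sub {T : E →ₗ.[ℂ] E} {z : ℂ} {R : E →L[ℂ] E}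
    (h : IsResolventAt T z R) (l : ℂ) (u : T.domain) :
    (z - l) • R (u : E) - u = R (T u - l • (u : E)) := by
  have h1 := h.1 u
  have h2 : z • (u : E) - T u = (z - l) • (u : E) - (T u - l • (u : E)) := by module
  rw [h2, map_sub, map_smul] at h1
  rw [sub_eq_iff_eq_add, ← sub_eq_iff_eq_add', h1]

/-- The first resolvent identity, $R'=R(1+(z-z')R')$, exhibits $R'$ as a compact operator composed
with a bounded one. -/
theorem IsResolventAt.isCompactOperator {T : E →ₗ.[ℂ] E} {z z' : ℂ} {R R' : E →L[ℂ] E}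
    (h : IsResolventAt T z R) (h' : IsResolventAt T z' R') (hR : IsCompactOperator R) :
    IsCompactOperator R' := by
  have e : R' = R.comp (ContinuousLinearMap.id ℂ E + (z - z') • R') := by
    ext f
    obtain ⟨hd, he⟩ := h'.2 f
    have h1 := h.1 ⟨_, hd⟩
    simp only [ContinuousLinearMap.comp_apply, _root_.add_apply,
      ContinuousLinearMap.id_apply, _root_.smul_apply]
    refine h1.symm.trans (congrArg R ?_)
    calc z • R' f - T ⟨_, hd⟩ = (z' • R' f - T ⟨_, hd⟩) + (z - z') • R' f := by module
      _ = _ := by rw [he]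
  rw [e]
  exact hR.comp_clm _

/-- Riesz's argument. Unit vectors $y_n\in V_{n+1}$ orthogonal to $V_n$ have images at mutual
distance at least $r$, so no subsequence of the images converges. Both the finiteness of the
spectrum away from $0$ and that of algebraic multiplicities reduce to the absence of such a chain.
-/
theorem IsCompactOperator.not_exists_chain {K : E →L[ℂ] E} (hK : IsCompactOperator K)
    {r : ℝ} (hr : 0 < r) (V : ℕ → Submodule ℂ E) [∀ n, FiniteDimensional ℂ (V n)]
    (hV : Monotone V) (hinv : ∀ n, ∀ y ∈ V n, K y ∈ V n) (x : ℕ → E) (m : ℕ → ℂ)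
    (hm : ∀ n, r ≤ ‖m n‖) (hx : ∀ n, x n ∈ V (n + 1)) (hx' : ∀ n, x n ∉ V n)
    (hKx : ∀ n, K (x n) - m n • x n ∈ V n) : False := by
  have key : ∀ n, ∃ y ∈ V (n + 1), ‖y‖ = 1 ∧ K y - m n • y ∈ V n ∧
      ∀ v ∈ V n, inner ℂ v y = 0 := by
    intro n
    set q := x n - (V n).starProjection (x n) with hq
    have hp : (V n).starProjection (x n) ∈ V n := Submodule.starProjection_apply_mem _ _
    have hq0 : q ≠ 0 := by
      intro h0
      rw [sub_eq_zero] at h0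
      exact hx' n (h0 ▸ hp)
    refine ⟨((‖q‖ : ℂ)⁻¹) • q, ?_, ?_, ?_, ?_⟩
    · exact Submodule.smul_mem _ _ (Submodule.sub_mem _ (hx n) (hV n.le_succ hp))
    · rw [norm_smul, norm_inv, Complex.norm_real, norm_norm, inv_mul_cancel₀ (norm_ne_zero_iff.2 hq0)]
    · have : K (((‖q‖ : ℂ)⁻¹) • q) - m n • ((‖q‖ : ℂ)⁻¹) • q = ((‖q‖ : ℂ)⁻¹) •
          ((K (x n) - m n • x n) - (K ((V n).starProjection (x n)) -
            m n • (V n).starProjection (x n))) := by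
        rw [hq, map_smul, map_sub]; module
      rw [this]
      exact Submodule.smul_mem _ _ (Submodule.sub_mem _ (hKx n)
        (Submodule.sub_mem _ (hinv n _ hp) (Submodule.smul_mem _ _ hp)))
    · intro v hv
      rw [inner_smul_right]
      have := Submodule.starProjection_inner_eq_zero (K := V n) (x n) v hv
      rw [← hq] at this
      rw [inner_eq_zero_symm.1 this, mul_zero]
  choose y hy hy1 hKy hyV using key
  have hsep : ∀ i j, i < j → r ≤ ‖K (y j) - K (y i)‖ := by
    intro i j hij
    -- For $i<j$ the difference of the images is $m_jy_j$ up to a vector of $V_j$, which pairing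
    -- with $y_j$ kills.
    set v := K (y i) - (K (y j) - m j • y j) with hv
    have hvV : v ∈ V j :=
      Submodule.sub_mem _ (hinv j _ (hV (Nat.succ_le_of_lt hij) (hy i))) (hKy j)
    have e : K (y j) - K (y i) = m j • y j - v := by rw [hv]; abel
    have h1 : inner ℂ (y j) (m j • y j - v) = m j := by
      rw [inner_sub_right, inner_smul_right, inner_self_eq_norm_sq_to_K, hy1 j,
        inner_eq_zero_symm.1 (hyV j v hvV)]
      simp
    calc r ≤ ‖m j‖ := hm j
      _ = ‖inner ℂ (y j) (m j • y j - v)‖ := by rw [h1]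
      _ ≤ ‖y j‖ * ‖m j • y j - v‖ := norm_inner_le_norm _ _
      _ = _ := by rw [hy1, one_mul, e]
  obtain ⟨C, hC, hC'⟩ := hK.image_closedBall_subset_compact 1
  obtain ⟨_, -, ψ, hψ, hψy⟩ := hC.tendsto_subseq
    (fun n => hC' ⟨y n, by simp [hy1], rfl⟩)
  obtain ⟨N, hN⟩ := Metric.cauchySeq_iff'.1 hψy.cauchySeq r hr
  have := hN (N + 1) N.le_succ
  rw [dist_eq_norm] at this
  exact absurd (hsep _ _ (hψ N.lt_succ_self)) (not_le.2 this)

/-- Adjoining such an $x$ to an invariant $V$ gives a larger invariant subspace; iterating from $0$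
builds a forbidden chain. -/
theorem IsCompactOperator.not_forall_exists_notMem {K : E →L[ℂ] E} (hK : IsCompactOperator K)
    {m : ℂ} (hm : m ≠ 0)
    (h : ∀ V : Submodule ℂ E, FiniteDimensional ℂ V → ∃ x, x ∉ V ∧ K x - m • x ∈ V) :
    False := by
  choose! x hx hx' using h
  let S := {V : Submodule ℂ E // FiniteDimensional ℂ V ∧ ∀ y ∈ V, K y ∈ V}
  let next : S → S := fun V => ⟨V.1 ⊔ Submodule.span ℂ {x V.1}, by
    have := V.2.1
    infer_instance, by
    have := V.2.1
    intro y hy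
    obtain ⟨v, hv, w, hw, rfl⟩ := Submodule.mem_sup.1 hy
    obtain ⟨c, rfl⟩ := Submodule.mem_span_singleton.1 hw
    rw [map_add, map_smul]
    refine Submodule.add_mem _ (Submodule.mem_sup_left (V.2.2 v hv)) (Submodule.smul_mem _ _ ?_)
    rw [← sub_add_cancel (K (x V.1)) (m • x V.1)]
    exact Submodule.add_mem _ (Submodule.mem_sup_left (hx' V.1 this))
      (Submodule.smul_mem _ _ (Submodule.mem_sup_right (Submodule.mem_span_singleton_self _)))⟩
  let W : ℕ → S := fun n => next^[n] ⟨⊥, inferInstance, by simp⟩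
  have hW : ∀ n, W (n + 1) = next (W n) := fun n => Function.iterate_succ_apply' _ _ _
  have : ∀ n, FiniteDimensional ℂ (W n).1 := fun n => (W n).2.1
  refine IsCompactOperator.not_exists_chain hK (norm_pos_iff.2 hm) (fun n => (W n).1) ?_
    (fun n => (W n).2.2) (fun n => x (W n).1) (fun _ => m) (fun _ => le_rfl) ?_ ?_ ?_
  · refine monotone_nat_of_le_succ fun n => ?_
    rw [hW]
    exact le_sup_left
  · intro n
    rw [hW]
    exact Submodule.mem_sup_right (Submodule.mem_span_singleton_self _)
  · exact fun n => hx _ (this n)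
  · exact fun n => hx' _ (this n)

/-- Eigenvectors for infinitely many distinct eigenvalues are independent, and their successive
spans form a forbidden chain. -/
theorem IsCompactOperator.finite_eigenvalues {K : E →L[ℂ] E} (hK : IsCompactOperator K)
    {r : ℝ} (hr : 0 < r) :
    {m : ℂ | r ≤ ‖m‖ ∧ Module.End.HasEigenvalue (K : Module.End ℂ E) m}.Finite := by
  by_contra hinf
  let m := Set.Infinite.natEmbedding _ hinf
  choose x hx using fun n => (m n).2.2.exists_hasEigenvector
  have hli : LinearIndependent ℂ x :=
    Module.End.eigenvectors_linearIndependent' (K : Module.End ℂ E) (fun n => (m n : ℂ))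
      (Subtype.val_injective.comp m.injective) x hx
  have hKx : ∀ n, K (x n) = (m n : ℂ) • x n := fun n => (hx n).apply_eq_smul
  have hfd : ∀ n, FiniteDimensional ℂ (Submodule.span ℂ (x '' Set.Iio n)) := fun n =>
    FiniteDimensional.span_of_finite ℂ ((Set.finite_Iio n).image x)
  refine IsCompactOperator.not_exists_chain hK hr
    (fun n => Submodule.span ℂ (x '' Set.Iio n)) ?_ ?_ x (fun n => m n) (fun n => (m n).2.1)
    ?_ ?_ ?_
  · exact fun i j hij => Submodule.span_mono (Set.image_mono (Set.Iio_subset_Iio hij))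
  · intro n y hy
    induction hy using Submodule.span_induction with
    | mem y hy =>
      obtain ⟨i, hi, rfl⟩ := hy
      rw [hKx]
      exact Submodule.smul_mem _ _ (Submodule.subset_span ⟨i, hi, rfl⟩)
    | zero => simp
    | add y z _ _ hy hz => rw [map_add]; exact Submodule.add_mem _ hy hz
    | smul c y _ hy => rw [map_smul]; exact Submodule.smul_mem _ _ hy
  · exact fun n => Submodule.subset_span ⟨n, Nat.lt_succ_self n, rfl⟩
  · exact fun n => hli.notMem_span_image (by simp)
  · intro n
    rw [hKx, sub_self]
    exact Submodule.zero_mem _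

/-- On $D(T)$ one has $w-T=(z-w)\,(m-R)\,(z-T)$ with $m=(z-w)^{-1}$; invertibility of the middle
factor makes the product invertible. -/
theorem IsResolventAt.mem_opResolventSet {T : E →ₗ.[ℂ] E} {z w : ℂ} {R : E →L[ℂ] E}
    (h : IsResolventAt T z R) (hw : w ≠ z) (hr : (z - w)⁻¹ ∈ resolventSet ℂ R) :
    w ∈ opResolventSet T := by
  have hzw : z - w ≠ 0 := sub_ne_zero.2 hw.symm
  obtain ⟨S, hS⟩ := spectrum.mem_resolventSet_iff.1 hr
  have h1 : ∀ f, (z - w)⁻¹ • (↑S⁻¹ : E →L[ℂ] E) f - R ((↑S⁻¹ : E →L[ℂ] E) f) = f := by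
    intro f
    have := congrArg (fun A : E →L[ℂ] E => A f) S.mul_inv
    rw [hS] at this
    simpa [Algebra.algebraMap_eq_smul_one] using this
  have h2 : ∀ f, (↑S⁻¹ : E →L[ℂ] E) ((z - w)⁻¹ • f - R f) = f := by
    intro f
    have := congrArg (fun A : E →L[ℂ] E => A f) S.inv_mul
    rw [hS] at this
    simpa [Algebra.algebraMap_eq_smul_one] using this
  refine ⟨(z - w)⁻¹ • R.comp (↑S⁻¹ : E →L[ℂ] E), ?_, ?_⟩
  · intro u
    have h3 : w • (u : E) - T u = (z • (u : E) - T u) - (z - w) • (u : E) := by module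
    set g := z • (u : E) - T u with hg
    have h4 : w • (u : E) - T u = (z - w) • ((z - w)⁻¹ • g - R g) := by
      rw [h3, h.1 u, smul_sub, smul_inv_smul₀ hzw]
    rw [h4, map_smul]
    simp only [_root_.smul_apply, ContinuousLinearMap.comp_apply]
    rw [h2, smul_inv_smul₀ hzw, h.1 u]
  · intro f
    obtain ⟨hd, he⟩ := h.2 ((z - w)⁻¹ • (↑S⁻¹ : E →L[ℂ] E) f)
    have e : ((z - w)⁻¹ • R.comp (↑S⁻¹ : E →L[ℂ] E)) f =
        R ((z - w)⁻¹ • (↑S⁻¹ : E →L[ℂ] E) f) := by simp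
    refine ⟨e ▸ hd, ?_⟩
    have h3 : T ⟨_, e ▸ hd⟩ = T ⟨_, hd⟩ := by congr 1; exact Subtype.ext e
    rw [h3, e]
    rw [sub_eq_iff_eq_add] at he
    have h5 := h1 f
    have h6 : R ((z - w)⁻¹ • (↑S⁻¹ : E →L[ℂ] E) f) =
      (z - w)⁻¹ • R ((↑S⁻¹ : E →L[ℂ] E) f) := map_smul _ _ _
    have h7 : (z - w) • R ((z - w)⁻¹ • (↑S⁻¹ : E →L[ℂ] E) f) = R ((↑S⁻¹ : E →L[ℂ] E) f) := by
      rw [h6, smul_inv_smul₀ hzw]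
    rw [← sub_eq_iff_eq_add] at he
    set p := R ((z - w)⁻¹ • (↑S⁻¹ : E →L[ℂ] E) f)
    calc w • p - T ⟨p, hd⟩ = (z • p - T ⟨p, hd⟩) - (z - w) • p := by module
      _ = _ := by rw [he, h7, h5]

theorem IsResolventAt.hasEigenvalue [CompleteSpace E] {T : E →ₗ.[ℂ] E} {z w : ℂ} {R : E →L[ℂ] E}
    (h : IsResolventAt T z R) (hR : IsCompactOperator R) (hw : w ∈ opSpectrum T) :
    w ≠ z ∧ Module.End.HasEigenvalue (R : Module.End ℂ E) (z - w)⁻¹ := by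
  have hwz : w ≠ z := by
    rintro rfl
    exact hw ⟨R, h⟩
  refine ⟨hwz, (IsCompactOperator.hasEigenvalue_or_mem_resolventSet hR
    (inv_ne_zero (sub_ne_zero.2 hwz.symm))).resolve_right fun hr => ?_⟩
  exact hw (h.mem_opResolventSet hwz hr)

theorem IsResolventAt.hasDiscreteSpectrum [CompleteSpace E] {T : E →ₗ.[ℂ] E} {z : ℂ} {R : E →L[ℂ] E}
    (h : IsResolventAt T z R) (hR : IsCompactOperator R) : HasDiscreteSpectrum T := by
  intro l hl
  obtain ⟨hlz, hev⟩ := h.hasEigenvalue hR hl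
  have hzl : z - l ≠ 0 := sub_ne_zero.2 hlz.symm
  refine ⟨?_, ?_, ?_⟩
  · set s : Set ℂ := {w | w ∈ opSpectrum T ∧ ‖w - l‖ < 1}
    have hfin : s.Finite := by
      -- Spectral points $w$ within distance $1$ of $l$ give eigenvalues $(z-w)^{-1}$ of $R$ of
      -- modulus at least this number.
      have hr : 0 < (‖z - l‖ + 1)⁻¹ := by positivity
      refine ((IsCompactOperator.finite_eigenvalues hR hr).preimage
        (f := fun w => (z - w)⁻¹) ?_).subset ?_
      · intro a _ b _ hab
        simpa using hab
      · rintro w ⟨hw, hwl⟩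
        obtain ⟨hwz, hwe⟩ := h.hasEigenvalue hR hw
        refine ⟨?_, hwe⟩
        rw [norm_inv]
        have : 0 < ‖z - w‖ := norm_pos_iff.2 (sub_ne_zero.2 hwz.symm)
        refine inv_anti₀ this ?_
        calc ‖z - w‖ = ‖(z - l) - (w - l)‖ := by congr 1; ring
          _ ≤ ‖z - l‖ + ‖w - l‖ := norm_sub_le _ _
          _ ≤ _ := by linarith
    have h1 : (s \ {l})ᶜ ∈ 𝓝 l :=
      (hfin.subset Set.sdiff_subset).isClosed.isOpen_compl.mem_nhds (by simp)
    have h2 : Metric.ball l 1 ∈ 𝓝 l := Metric.ball_mem_nhds l one_pos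
    filter_upwards [mem_nhdsWithin_of_mem_nhds h1, mem_nhdsWithin_of_mem_nhds h2,
      self_mem_nhdsWithin] with w hw1 hw2 hw3 hw
    exact hw1 ⟨⟨hw, by simpa [dist_eq_norm] using hw2⟩, hw3⟩
  · obtain ⟨x, hx⟩ := hev.exists_hasEigenvector
    have hRx : R x = (z - l)⁻¹ • x := hx.apply_eq_smul
    obtain ⟨hd, he⟩ := h.2 ((z - l) • x)
    have e : R ((z - l) • x) = x := by rw [map_smul, hRx, smul_inv_smul₀ hzl]
    have hd' : x ∈ T.domain := e ▸ hd
    have e' : T ⟨_, hd⟩ = T ⟨x, hd'⟩ := by congr 1; exact Subtype.ext e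
    refine ⟨⟨x, hd'⟩, hx.2, ?_⟩
    rw [e', e] at he
    rw [sub_eq_iff_eq_add, ← sub_eq_iff_eq_add', ← sub_smul] at he
    rw [← he]
    congr 1
    ring
  · set m := (z - l)⁻¹ with hmdef
    have hm : m ≠ 0 := inv_ne_zero hzl
    -- That is, $(R-m)^nu=0$. The induction uses $(R-m)u=mR(T-l)u$ and the commutation of $R$ with
    -- $(R-m)^n$.
    have hker : ∀ n, ∀ u ∈ kerPow T l n,
        ((R : Module.End ℂ E) - m • 1) ^ n ∈ LinearMap.ker (LinearMap.applyₗ (R := ℂ) u) := by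
      intro n
      induction n with
      | zero =>
        intro u hu
        have : u = 0 := hu
        simp [this]
      | succ n ih =>
        rintro _ ⟨u, hu, rfl⟩
        have hu' : T u - l • (u : E) ∈ kerPow T l n := hu
        have h1 := h.smul_apply_sub l u
        have h2 := ih _ hu'
        simp only [LinearMap.mem_ker, LinearMap.applyₗ_apply_apply] at h2 ⊢
        have h3 : ((R : Module.End ℂ E) - m • 1) (u : E) = m • R (T u - l • (u : E)) := by
          rw [← h1, smul_sub, hmdef, inv_smul_smul₀ hzl]
          simp
        have hc : Commute (((R : Module.End ℂ E) - m • 1) ^ n) (R : Module.End ℂ E) := by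
          refine Commute.pow_left ?_ n
          exact (Commute.refl _).sub_left ((Commute.one_left _).smul_left m)
        rw [Submodule.subtype_apply, pow_succ, Module.End.mul_apply, h3, map_smul]
        have h4 := congrArg (fun A : Module.End ℂ E => A (T u - l • (u : E))) hc.eq
        simp only [Module.End.mul_apply] at h4
        rw [h2, map_zero] at h4
        rw [show R (T u - l • (u : E)) = (R : Module.End ℂ E) (T u - l • (u : E)) from rfl,
          h4, smul_zero]
    have hmono : Monotone (kerPow T l) := by
      refine monotone_nat_of_le_succ fun n => ?_
      induction n with
      | zero => exact bot_le
      | succ n ih => exact Submodule.map_mono (Submodule.comap_mono ih)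
    by_contra hinf
    refine IsCompactOperator.not_forall_exists_notMem hR hm fun V hV => ?_
    have : ∃ x ∈ algEigenspace T l, x ∉ V := by
      by_contra! hcon
      exact hinf (Submodule.finiteDimensional_of_le (S₂ := V) hcon)
    obtain ⟨x, hx, hxV⟩ := this
    obtain ⟨n, hn⟩ := (Submodule.mem_iSup_of_directed _ hmono.directed_le).1 hx
    have h0 := hker n x hn
    simp only [LinearMap.mem_ker, LinearMap.applyₗ_apply_apply] at h0
    -- Powers of $R-m$ eventually send $x\notin V$ into $V$. The last iterate still outside $V$ is
    -- the vector required.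
    have hex : ∃ j : ℕ, (((R : Module.End ℂ E) - m • 1) ^ j : Module.End ℂ E) x ∈ V := ⟨n, by rw [h0]; exact V.zero_mem⟩
    classical
    have hj0 : Nat.find hex ≠ 0 := by
      intro h0
      have := Nat.find_spec hex
      rw [h0] at this
      exact hxV this
    obtain ⟨j, hj⟩ := Nat.exists_eq_succ_of_ne_zero hj0
    refine ⟨(((R : Module.End ℂ E) - m • 1) ^ j : Module.End ℂ E) x, Nat.find_min hex (m := j) (by omega), ?_⟩
    have := Nat.find_spec hex
    rw [hj, Nat.succ_eq_add_one, pow_succ', Module.End.mul_apply] at this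
    simpa using this

end Abstract

/-! ### Test functions on the line -/

section TestFunctions

variable {F : Type*} [NormedAddCommGroup F] [NormedSpace ℝ F]

/-- Smooth functions of compact support on the line. -/
structure IsTest (φ : ℝ → F) : Prop where
  contDiff : ContDiff ℝ ∞ φ
  hasCompactSupport : HasCompactSupport φ

theorem IsTest.continuous {φ : ℝ → F} (h : IsTest φ) : Continuous φ := h.contDiff.continuous

theorem IsTest.differentiable {φ : ℝ → F} (h : IsTest φ) : Differentiable ℝ φ :=
  h.contDiff.differentiable (by simp)

theorem IsTest.hasDerivAt {φ : ℝ → F} (h : IsTest φ) (x : ℝ) : HasDerivAt φ (deriv φ x) x :=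
  (h.differentiable x).hasDerivAt

theorem IsTest.isTest_deriv {φ : ℝ → F} (h : IsTest φ) : IsTest (deriv φ) :=
  ⟨(contDiff_infty_iff_deriv.1 h.contDiff).2, h.hasCompactSupport.deriv⟩

theorem IsTest.integrable {φ : ℝ → F} (h : IsTest φ) : Integrable φ :=
  h.continuous.integrable_of_hasCompactSupport h.hasCompactSupport

theorem IsTest.add {φ ψ : ℝ → F} (h : IsTest φ) (h' : IsTest ψ) : IsTest (φ + ψ) :=
  ⟨h.contDiff.add h'.contDiff, h.hasCompactSupport.add h'.hasCompactSupport⟩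

theorem IsTest.const_smul {𝕜 : Type*} [NormedField 𝕜] [NormedSpace 𝕜 F]
    [SMulCommClass ℝ 𝕜 F] {φ : ℝ → F} (c : 𝕜) (h : IsTest φ) : IsTest (c • φ) :=
  ⟨h.contDiff.const_smul c, h.hasCompactSupport.smul_left (f := fun _ => c)⟩

theorem IsTest.ofReal {φ : ℝ → ℝ} (h : IsTest φ) : IsTest (fun x => (φ x : ℂ)) :=
  ⟨Complex.ofRealCLM.contDiff.comp h.contDiff,
    h.hasCompactSupport.comp_left (g := fun x : ℝ => (x : ℂ)) Complex.ofReal_zero⟩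

theorem deriv_ofReal_comp {φ : ℝ → ℝ} (h : Differentiable ℝ φ) :
    deriv (fun x => (φ x : ℂ)) = fun x => ((deriv φ x : ℝ) : ℂ) :=
  funext fun x => (h x).hasDerivAt.ofReal_comp.deriv

theorem integral_eq_zero_of_hasDerivAt_of_hasCompactSupport {f f' : ℝ → F}
    (h : ∀ x, HasDerivAt f (f' x) x) (hf : HasCompactSupport f) (hf' : Continuous f') :
    Integrable f' volume ∧ ∫ x, f' x = 0 := by
  have e : f' = _root_.deriv f := funext fun x => (h x).deriv.symm
  have hc : HasCompactSupport f' := e ▸ hf.deriv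
  have hcont : Continuous f := continuous_iff_continuousAt.2 fun x => (h x).continuousAt
  have hi : Integrable f' volume := hf'.integrable_of_hasCompactSupport hc
  exact ⟨hi, integral_eq_zero_of_hasDerivAt_of_integrable h hi
    (hcont.integrable_of_hasCompactSupport hf)⟩

theorem IsTest.exists_Icc {φ : ℝ → F} (h : IsTest φ) :
    ∃ A : ℝ, 0 < A ∧ ∀ x, x ∉ Set.Ioo (-A) A → φ x = 0 := by
  obtain ⟨r, hr⟩ := h.hasCompactSupport.isCompact.isBounded.subset_ball 0
  refine ⟨max r 1, by positivity, fun x hx => ?_⟩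
  by_contra hne
  have h1 := hr (subset_tsupport φ hne)
  rw [Metric.mem_ball, dist_zero_right, Real.norm_eq_abs, abs_lt] at h1
  exact hx ⟨by linarith [le_max_left r 1], lt_of_lt_of_le h1.2 (le_max_left r 1)⟩

end TestFunctions

/-! ### The du Bois-Reymond lemma in orders one and two -/

/-- A normalised bump function. -/
def unitBump : ContDiffBump (0 : ℝ) := ⟨1, 2, one_pos, one_lt_two⟩

theorem isTest_normed : IsTest (unitBump.normed volume) :=
  ⟨unitBump.contDiff_normed, unitBump.hasCompactSupport_normed⟩

/-- The primitive started to the left of the support vanishes there, and vanishes to the right of it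
because the total integral is zero. -/
theorem IsTest.exists_antideriv {ψ : ℝ → ℝ} (h : IsTest ψ) (h0 : ∫ x, ψ x = 0) :
    ∃ φ : ℝ → ℝ, IsTest φ ∧ deriv φ = ψ := by
  obtain ⟨A, hA, hψ⟩ := h.exists_Icc
  let φ : ℝ → ℝ := fun x => ∫ y in (-A)..x, ψ y
  have hd : ∀ x, HasDerivAt φ (ψ x) x := fun x =>
    h.continuous.integral_hasStrictDerivAt _ _ |>.hasDerivAt
  have hd' : deriv φ = ψ := funext fun x => (hd x).deriv
  have h1 : ∀ x, x ≤ -A → φ x = 0 := by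
    intro x hx
    refine intervalIntegral.integral_zero_ae (Eventually.of_forall fun y hy => ?_)
    rw [Set.uIoc_of_ge hx] at hy
    exact hψ y fun hy' => absurd hy.2 (not_le.2 hy'.1)
  have h2 : ∀ x, A ≤ x → φ x = 0 := by
    intro x hx
    have : φ x = ∫ y, ψ y := by
      refine intervalIntegral.integral_eq_integral_of_support_subset fun y hy => ?_
      by_contra hy'
      exact hy (hψ y fun h3 => hy' ⟨h3.1, (h3.2.le.trans hx)⟩)
    rw [this, h0]
  refine ⟨φ, ⟨contDiff_infty_iff_deriv.2 ⟨fun x => (hd x).differentiableAt, hd' ▸ h.contDiff⟩, ?_⟩,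
    hd'⟩
  refine HasCompactSupport.intro (K := Set.Icc (-A) A) isCompact_Icc fun x hx => ?_
  rw [Set.mem_Icc, not_and_or, not_le, not_le] at hx
  exact hx.elim (fun h => h1 x h.le) (fun h => h2 x h.le)

theorem IsTest.integrable_smul {φ : ℝ → ℝ} (h : IsTest φ) {f : ℝ → ℂ}
    (hf : LocallyIntegrable f) : Integrable fun x => φ x • f x :=
  hf.integrable_smul_left_of_hasCompactSupport h.continuous h.hasCompactSupport

/-- Every test function is the sum of the derivative of a test function and a multiple of a fixed
bump. -/
theorem IsTest.exists_deriv_eq_sub {ψ : ℝ → ℝ} (h : IsTest ψ) :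
    ∃ φ : ℝ → ℝ, IsTest φ ∧ deriv φ = ψ + (-∫ x, ψ x) • unitBump.normed volume := by
  refine IsTest.exists_antideriv (h.add (isTest_normed.const_smul _)) ?_
  simp only [Pi.add_apply, Pi.smul_apply]
  have hI : Integrable (fun x => (-∫ x, ψ x) • unitBump.normed volume x) :=
    isTest_normed.integrable.fun_smul _
  rw [integral_add h.integrable hI, integral_smul, ContDiffBump.integral_normed]
  simp

/-- Up to a derivative, which $f$ annihilates, every test function is its integral times the fixed
bump; so $f$ acts on it as a constant does. -/
theorem ae_eq_const_of_integral_deriv_smul_eq_zero {f : ℝ → ℂ} (hf : LocallyIntegrable f)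
    (h : ∀ φ : ℝ → ℝ, IsTest φ → ∫ x, deriv φ x • f x = 0) : ∃ c, ∀ᵐ x, f x = c := by
  refine ⟨∫ x, unitBump.normed volume x • f x, ae_eq_of_integral_contDiff_smul_eq hf
    continuous_const.locallyIntegrable fun ψ hψ hψc => ?_⟩
  have ht : IsTest ψ := ⟨hψ, hψc⟩
  obtain ⟨φ, hφ, hd⟩ := ht.exists_deriv_eq_sub
  have h1 := h φ hφ
  simp only [hd, Pi.add_apply, Pi.smul_apply, add_smul, smul_assoc] at h1
  have hI : Integrable (fun x => (-∫ x, ψ x) • unitBump.normed volume x • f x) :=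
    (isTest_normed.integrable_smul hf).fun_smul _
  rw [integral_add (ht.integrable_smul hf) hI,
    integral_smul, neg_smul, ← sub_eq_add_neg, sub_eq_zero] at h1
  rw [h1, integral_smul_const]

theorem IsTest.integral_deriv_mul_id {ψ : ℝ → ℝ} (h : IsTest ψ) :
    ∫ x, deriv ψ x * x = -∫ x, ψ x := by
  have hx : Continuous (fun x : ℝ => x) := continuous_id
  have h1 := integral_eq_zero_of_hasDerivAt_of_hasCompactSupport
    (f := fun x => ψ x * x) (f' := fun x => deriv ψ x * x + ψ x * 1)
    (fun x => (h.hasDerivAt x).mul (hasDerivAt_id x)) h.hasCompactSupport.mul_right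
    ((h.isTest_deriv.continuous.mul hx).add (h.continuous.mul continuous_const))
  have h2 : Integrable (fun x => deriv ψ x * x) :=
    (h.isTest_deriv.continuous.mul hx).integrable_of_hasCompactSupport h.isTest_deriv.hasCompactSupport.mul_right
  have h3 := h1.2
  simp only [mul_one] at h3
  rw [integral_add h2 h.integrable] at h3
  linarith

/-- The weak derivative of $f$ acts as the constant $-m$, $m$ being the pairing of $f$ with the
derivative of the bump. So $f+mx$ has zero weak derivative, which is the first-order case. -/
theorem ae_eq_affine_of_integral_deriv_deriv_smul_eq_zero {f : ℝ → ℂ}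
    (hf : LocallyIntegrable f)
    (h : ∀ φ : ℝ → ℝ, IsTest φ → ∫ x, deriv (deriv φ) x • f x = 0) :
    ∃ c m : ℂ, ∀ᵐ x : ℝ, f x = c + x * m := by
  set m := ∫ x, deriv (unitBump.normed volume) x • f x
  have hlin : LocallyIntegrable (fun x : ℝ => (x : ℂ) * m) :=
    (by fun_prop : Continuous (fun x : ℝ => (x : ℂ) * m)).locallyIntegrable
  obtain ⟨c, hc⟩ := ae_eq_const_of_integral_deriv_smul_eq_zero (f := fun x => f x + x * m)
    (hf.add hlin) (by
      intro ψ hψ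
      obtain ⟨φ, hφ, hd⟩ := hψ.exists_deriv_eq_sub
      have h1 := h φ hφ
      have hdd : deriv (deriv φ) =
          deriv ψ + (-∫ x, ψ x) • deriv (unitBump.normed volume) := by
        rw [hd]
        funext x
        exact ((hψ.hasDerivAt x).add ((isTest_normed.hasDerivAt x).const_smul _)).deriv
      simp only [hdd, Pi.add_apply, Pi.smul_apply, add_smul, smul_assoc] at h1
      have hI : Integrable (fun x => (-∫ x, ψ x) • deriv (unitBump.normed volume) x • f x) :=
        (isTest_normed.isTest_deriv.integrable_smul hf).fun_smul _
      rw [integral_add (hψ.isTest_deriv.integrable_smul hf) hI, integral_smul] at h1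
      simp only [smul_add]
      rw [integral_add (hψ.isTest_deriv.integrable_smul hf) (hψ.isTest_deriv.integrable_smul hlin)]
      have h2 : ∫ x : ℝ, deriv ψ x • ((x : ℂ) * m) = (-∫ x, ψ x) • m := by
        rw [← hψ.integral_deriv_mul_id, ← integral_smul_const]
        refine integral_congr_ae (Eventually.of_forall fun x => ?_)
        simp [mul_assoc]
      rw [h2]
      exact h1)
  refine ⟨c, -m, ?_⟩
  filter_upwards [hc] with x hx
  rw [← hx]
  ring

/-! ### Regularity of weak solutions -/

theorem intervalIntegrable_of_locallyIntegrable {F : Type*} [NormedAddCommGroup F] {g : ℝ → F}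
    (hg : LocallyIntegrable g) (a b : ℝ) : IntervalIntegrable g volume a b :=
  intervalIntegrable_iff.mpr <|
    (hg.integrableOn_isCompact isCompact_uIcc).mono_set Set.uIoc_subset_uIcc

/-- The primitive of a locally integrable function is absolutely continuous, so integration by parts
holds on an interval containing the supports of `φ` and its derivative. -/
theorem IsTest.integral_deriv_mul_primitive_real {φ : ℝ → ℝ} (h : IsTest φ) {g : ℝ → ℝ}
    (hg : LocallyIntegrable g) :
    ∫ x, (deriv φ x * (∫ t in (0 : ℝ)..x, g t) + φ x * g x) = 0 := by
  obtain ⟨A, hA, hφ⟩ := h.exists_Icc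
  obtain ⟨B, hB, hφ'⟩ := h.isTest_deriv.exists_Icc
  set C := max A B
  have hAC : A ≤ C := le_max_left _ _
  have hBC : B ≤ C := le_max_right _ _
  have hI : ∀ {r : ℝ}, r ≤ C → Set.Ioo (-r) r ⊆ Set.Ioo (-C) C :=
    fun h => Set.Ioo_subset_Ioo (neg_le_neg h) h
  have h0 : (0 : ℝ) ∈ Set.uIcc (-C) C := by
    rw [Set.uIcc_of_le (by linarith)]
    constructor <;> linarith
  have hG := (intervalIntegrable_of_locallyIntegrable hg
    (-C) C).absolutelyContinuousOnInterval_intervalIntegral h0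
  have hφac : AbsolutelyContinuousOnInterval φ (-C) C :=
    ContDiffOn.absolutelyContinuousOnInterval (h.contDiff.of_le (by simp)).contDiffOn
  have h1 := hφac.integral_deriv_mul_eq_sub hG
  rw [hφ C (fun hh => absurd hh.2 (not_lt.2 hAC)),
    hφ (-C) (fun hh => absurd hh.1 (not_lt.2 (neg_le_neg hAC))), zero_mul, zero_mul, sub_zero] at h1
  rw [← intervalIntegral.integral_eq_integral_of_support_subset (a := -C) (b := C)]
  · refine Eq.trans ?_ h1
    refine intervalIntegral.integral_congr_ae ?_
    filter_upwards [_root_.LocallyIntegrable.ae_hasDerivAt_integral hg] with x hx _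
    rw [(hx 0).deriv]
  · intro x hx
    by_contra hx'
    refine hx ?_
    have h2 : x ∉ Set.Ioo (-C) C := fun h => hx' ⟨h.1, h.2.le⟩
    simp only
    rw [hφ x fun h => h2 (hI hAC h), hφ' x fun h => h2 (hI hBC h), zero_mul, zero_mul, add_zero]

theorem IsTest.integral_deriv_smul_primitive {φ : ℝ → ℝ} (h : IsTest φ) {g : ℝ → ℂ}
    (hg : LocallyIntegrable g) :
    ∫ x, deriv φ x • (∫ t in (0 : ℝ)..x, g t) = -∫ x, φ x • g x := by
  have hgI := intervalIntegrable_of_locallyIntegrable hg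
  have hGc : Continuous (fun x => ∫ t in (0 : ℝ)..x, g t) :=
    intervalIntegral.continuous_primitive hgI 0
  have i1 := h.isTest_deriv.integrable_smul hGc.locallyIntegrable
  have i2 := h.integrable_smul hg
  rw [eq_neg_iff_add_eq_zero, ← integral_add i1 i2]
  have hre : LocallyIntegrable (fun x => (g x).re) := fun x => by
    obtain ⟨s, hs, hi⟩ := hg x
    exact ⟨s, hs, hi.re⟩
  have him : LocallyIntegrable (fun x => (g x).im) := fun x => by
    obtain ⟨s, hs, hi⟩ := hg x
    exact ⟨s, hs, hi.im⟩
  have i3 := i1.add i2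
  refine Complex.ext ?_ ?_
  · refine Eq.trans ?_ (h.integral_deriv_mul_primitive_real hre)
    refine (integral_re i3).symm.trans (integral_congr_ae (Eventually.of_forall fun x => ?_))
    have : (∫ t in (0 : ℝ)..x, g t).re = ∫ t in (0 : ℝ)..x, (g t).re :=
      (Complex.reCLM.intervalIntegral_comp_comm (hgI 0 x)).symm
    simp [this]
  · refine Eq.trans ?_ (h.integral_deriv_mul_primitive_real him)
    refine (integral_im i3).symm.trans (integral_congr_ae (Eventually.of_forall fun x => ?_))
    have : (∫ t in (0 : ℝ)..x, g t).im = ∫ t in (0 : ℝ)..x, (g t).im :=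
      (Complex.imCLM.intervalIntegral_comp_comm (hgI 0 x)).symm
    simp [this]

/-- Regularity of weak solutions of `v'' = W v` for continuous `W`. -/
theorem exists_hasDerivAt_of_weak_solution {v W : ℝ → ℂ} (hv : LocallyIntegrable v)
    (hW : Continuous W)
    (h : ∀ φ : ℝ → ℝ, IsTest φ → ∫ x, deriv (deriv φ) x • v x = ∫ x, φ x • (W x * v x)) :
    ∃ w w' : ℝ → ℂ, (∀ x, HasDerivAt w (w' x) x) ∧ (∀ x, HasDerivAt w' (W x * w x) x) ∧
      ∀ᵐ x, v x = w x := by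
  have hg : LocallyIntegrable (fun x => W x * v x) := hv.continuous_mul hW
  set g := fun x => W x * v x with hgdef
  set G1 : ℝ → ℂ := fun x => ∫ t in (0 : ℝ)..x, g t with hG1
  have hG1c : Continuous G1 :=
    intervalIntegral.continuous_primitive (intervalIntegrable_of_locallyIntegrable hg) 0
  set G : ℝ → ℂ := fun x => ∫ t in (0 : ℝ)..x, G1 t with hG
  have hGd : ∀ x, HasDerivAt G (G1 x) x := fun x =>
    (hG1c.integral_hasStrictDerivAt 0 x).hasDerivAt
  have hGc : Continuous G := continuous_iff_continuousAt.2 fun x => (hGd x).continuousAt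
  -- Here $G$ is a double primitive of $Wv$, so $v-G$ has zero second weak derivative and is affine.
  obtain ⟨c, m, hcm⟩ := ae_eq_affine_of_integral_deriv_deriv_smul_eq_zero (f := fun x => v x - G x)
    (hv.sub hGc.locallyIntegrable) (by
      intro φ hφ
      simp only [smul_sub]
      rw [integral_sub (hφ.isTest_deriv.isTest_deriv.integrable_smul hv)
        (hφ.isTest_deriv.isTest_deriv.integrable_smul hGc.locallyIntegrable), h φ hφ,
        hφ.isTest_deriv.integral_deriv_smul_primitive hG1c.locallyIntegrable,
        hφ.integral_deriv_smul_primitive hg, neg_neg, sub_self])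
  set w : ℝ → ℂ := fun x => G x + (c + x * m) with hw
  have hvw : ∀ᵐ x, v x = w x := by
    filter_upwards [hcm] with x hx
    rw [hw]
    simp only
    rw [← hx]
    ring
  have hwd : ∀ x, HasDerivAt w (G1 x + m) x := by
    intro x
    have h1 : HasDerivAt (fun x : ℝ => c + (x : ℂ) * m) (1 * m) x :=
      ((hasDerivAt_id x).ofReal_comp.mul_const m).const_add c
    rw [one_mul] at h1
    exact (hGd x).add h1
  have hwc : Continuous w := continuous_iff_continuousAt.2 fun x => (hwd x).continuousAt
  -- Replacing $v$ under the integral by its continuous representative $w$ makes the first primitive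
  -- continuously differentiable; this is the bootstrap.
  have hG1' : G1 = fun x => ∫ t in (0 : ℝ)..x, W t * w t := by
    funext x
    refine intervalIntegral.integral_congr_ae ?_
    filter_upwards [hvw] with t ht _
    rw [hgdef]
    simp only [ht]
  refine ⟨w, fun x => G1 x + m, hwd, fun x => ?_, hvw⟩
  have := ((hW.mul hwc).integral_hasStrictDerivAt 0 x).hasDerivAt.add_const m
  rw [hG1']
  exact this

/-! ### Vanishing of square-integrable weak solutions -/

theorem IsTest.exists_bound {φ : ℝ → ℝ} (h : IsTest φ) : ∃ M, ∀ x, |φ x| ≤ M :=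
  h.continuous.bounded_above_of_compact_support h.hasCompactSupport

theorem IsTest.comp_mul {φ : ℝ → ℝ} (h : IsTest φ) {c : ℝ} (hc : c ≠ 0) :
    IsTest (fun x => φ (c * x)) :=
  ⟨h.contDiff.comp (contDiff_const.mul contDiff_id),
    h.hasCompactSupport.comp_homeomorph (Homeomorph.mulLeft₀ c hc)⟩

/-- Caccioppoli-type estimate for `a w'' = W w`. -/
theorem caccioppoli {w w' W : ℝ → ℂ} {a : ℂ} (ha : 0 < a.re) (hW : Continuous W)
    {δ : ℝ} (hδ : ∀ x, δ ≤ (W x).re) (hw : ∀ x, HasDerivAt w (w' x) x)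
    (hw' : ∀ x, HasDerivAt w' (W x * a⁻¹ * w x) x) {η : ℝ → ℝ} (hη : IsTest η) :
    δ * ∫ x, η x ^ 2 * ‖w x‖ ^ 2 ≤ ‖a‖ ^ 2 / a.re * ∫ x, deriv η x ^ 2 * ‖w x‖ ^ 2 := by
  have ha0 : a ≠ 0 := by rintro rfl; simp at ha
  have hwc : Continuous w := continuous_iff_continuousAt.2 fun x => (hw x).continuousAt
  have hwc' : Continuous w' := continuous_iff_continuousAt.2 fun x => (hw' x).continuousAt
  have hηc := hη.continuous
  have hηc' := hη.isTest_deriv.continuous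
  -- The derivative of $\eta^2\,a\,w'\bar w$, with $aw''$ replaced by $Ww$. Its integral vanishes.
  set f' : ℝ → ℂ := fun x => ((2 * η x * deriv η x : ℝ) : ℂ) * (a * w' x * conj (w x)) +
    ((η x ^ 2 : ℝ) : ℂ) * (W x * w x * conj (w x) + a * w' x * conj (w' x)) with hf'
  have hd : ∀ x, HasDerivAt (fun x => ((η x ^ 2 : ℝ) : ℂ) * (a * w' x * conj (w x))) (f' x) x := by
    intro x
    have h1 : HasDerivAt (fun x => ((η x ^ 2 : ℝ) : ℂ)) ((2 * η x * deriv η x : ℝ) : ℂ) x := by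
      have := ((hη.hasDerivAt x).pow 2).ofReal_comp
      simpa using this
    have h2 : HasDerivAt (fun x => conj (w x)) (conj (w' x)) x := (hw x).star
    have h3 := h1.mul (((hw' x).const_mul a).mul h2)
    refine h3.congr_deriv ?_
    rw [hf']
    simp only
    congr 2
    field_simp
  have hc : HasCompactSupport (fun x => ((η x ^ 2 : ℝ) : ℂ) * (a * w' x * conj (w x))) := by
    have : HasCompactSupport (fun x => ((η x ^ 2 : ℝ) : ℂ)) :=
      hη.hasCompactSupport.comp_left (g := fun t : ℝ => ((t ^ 2 : ℝ) : ℂ)) (by simp)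
    exact this.mul_right
  have hf'c : Continuous f' := by fun_prop
  obtain ⟨hi, h0⟩ := integral_eq_zero_of_hasDerivAt_of_hasCompactSupport hd hc hf'c
  have hre : ∫ x, (f' x).re = 0 := by
    have := integral_re hi
    simp only [RCLike.re_to_complex] at this
    rw [this, h0, Complex.zero_re]
  have i1 : Integrable (fun x => δ * (η x ^ 2 * ‖w x‖ ^ 2)) := by
    refine Continuous.integrable_of_hasCompactSupport (by fun_prop) ?_
    have : HasCompactSupport (fun x => η x ^ 2) :=
      hη.hasCompactSupport.comp_left (g := fun t : ℝ => t ^ 2) (by simp)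
    exact this.mul_right.mul_left
  have i2 : Integrable (fun x => ‖a‖ ^ 2 / a.re * (deriv η x ^ 2 * ‖w x‖ ^ 2)) := by
    refine Continuous.integrable_of_hasCompactSupport (by fun_prop) ?_
    have : HasCompactSupport (fun x => deriv η x ^ 2) :=
      hη.isTest_deriv.hasCompactSupport.comp_left (g := fun t : ℝ => t ^ 2) (by simp)
    exact this.mul_right.mul_left
  have i3 : Integrable (fun x => (f' x).re) := hi.re
  have key : ∀ x, δ * (η x ^ 2 * ‖w x‖ ^ 2) ≤
      ‖a‖ ^ 2 / a.re * (deriv η x ^ 2 * ‖w x‖ ^ 2) + (f' x).re := by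
    intro x
    have e1 : (W x * w x * conj (w x) + a * w' x * conj (w' x)).re =
        (W x).re * ‖w x‖ ^ 2 + a.re * ‖w' x‖ ^ 2 := by
      rw [mul_assoc, mul_assoc, Complex.mul_conj, Complex.mul_conj, Complex.add_re,
        Complex.re_mul_ofReal, Complex.re_mul_ofReal, Complex.normSq_eq_norm_sq,
        Complex.normSq_eq_norm_sq]
    have e2 : (f' x).re = 2 * η x * deriv η x * (a * w' x * conj (w x)).re +
        η x ^ 2 * ((W x).re * ‖w x‖ ^ 2 + a.re * ‖w' x‖ ^ 2) := by
      rw [hf']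
      simp only
      rw [Complex.add_re, Complex.re_ofReal_mul, Complex.re_ofReal_mul, e1]
    have e3 : |(a * w' x * conj (w x)).re| ≤ ‖a‖ * ‖w' x‖ * ‖w x‖ := by
      refine (Complex.abs_re_le_norm _).trans_eq ?_
      rw [norm_mul, norm_mul, Complex.norm_conj]
    have e4 : -(2 * (|η x| * ‖w' x‖) * (‖a‖ * (|deriv η x| * ‖w x‖))) ≤
        2 * η x * deriv η x * (a * w' x * conj (w x)).re := by
      refine neg_le_of_neg_le ((neg_le_abs _).trans ?_)
      rw [abs_mul, abs_mul, abs_mul, abs_two]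
      calc 2 * |η x| * |deriv η x| * |(a * w' x * conj (w x)).re|
          ≤ 2 * |η x| * |deriv η x| * (‖a‖ * ‖w' x‖ * ‖w x‖) := by gcongr
        _ = _ := by ring
    -- The weights in Young's inequality are such that the $w'$ part equals the good term
    -- $\operatorname{Re}a\,\eta^2|w'|^2$ and cancels it.
    have e5 : 2 * (|η x| * ‖w' x‖) * (‖a‖ * (|deriv η x| * ‖w x‖)) ≤
        a.re * (|η x| * ‖w' x‖) ^ 2 + (‖a‖ * (|deriv η x| * ‖w x‖)) ^ 2 / a.re := by
      rw [← sub_nonneg]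
      have : a.re * (|η x| * ‖w' x‖) ^ 2 + (‖a‖ * (|deriv η x| * ‖w x‖)) ^ 2 / a.re -
        2 * (|η x| * ‖w' x‖) * (‖a‖ * (|deriv η x| * ‖w x‖)) =
        (a.re * (|η x| * ‖w' x‖) - ‖a‖ * (|deriv η x| * ‖w x‖)) ^ 2 / a.re := by
        field_simp
        ring
      rw [this]
      positivity
    have e6 : (‖a‖ * (|deriv η x| * ‖w x‖)) ^ 2 / a.re =
        ‖a‖ ^ 2 / a.re * (deriv η x ^ 2 * ‖w x‖ ^ 2) := by
      rw [mul_pow, mul_pow, sq_abs]; ring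
    have e7 : a.re * (|η x| * ‖w' x‖) ^ 2 = η x ^ 2 * (a.re * ‖w' x‖ ^ 2) := by
      rw [mul_pow, sq_abs]; ring
    have e8 : δ * (η x ^ 2 * ‖w x‖ ^ 2) ≤ η x ^ 2 * ((W x).re * ‖w x‖ ^ 2) := by
      have := mul_le_mul_of_nonneg_right (hδ x) (by positivity : 0 ≤ η x ^ 2 * ‖w x‖ ^ 2)
      linarith
    rw [e2]
    linarith
  rw [← integral_const_mul, ← integral_const_mul]
  calc ∫ x, δ * (η x ^ 2 * ‖w x‖ ^ 2)
      ≤ ∫ x, (‖a‖ ^ 2 / a.re * (deriv η x ^ 2 * ‖w x‖ ^ 2) + (f' x).re) :=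
        integral_mono i1 (i2.add i3) key
    _ = _ := by rw [integral_add i2 i3, hre, add_zero]

/-- A square-integrable weak solution of `a v'' = W v` with `Re a > 0` and `Re W ≥ δ > 0`
vanishes. -/
theorem weak_solution_ae_eq_zero {v W : ℝ → ℂ} (hv : MemLp v 2) {a : ℂ} (ha : 0 < a.re)
    (hW : Continuous W) {δ : ℝ} (hδ0 : 0 < δ) (hδ : ∀ x, δ ≤ (W x).re)
    (h : ∀ φ : ℝ → ℝ, IsTest φ →
      a * ∫ x, deriv (deriv φ) x • v x = ∫ x, φ x • (W x * v x)) :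
    ∀ᵐ x, v x = 0 := by
  have ha0 : a ≠ 0 := by rintro rfl; simp at ha
  obtain ⟨w, w', hw, hw', hvw⟩ := exists_hasDerivAt_of_weak_solution
    (W := fun x => W x * a⁻¹) (hv.locallyIntegrable (by norm_num)) (by fun_prop) (by
      intro φ hφ
      have h1 := h φ hφ
      rw [mul_comm, ← eq_mul_inv_iff_mul_eq₀ ha0] at h1
      rw [h1, ← integral_mul_const]
      refine integral_congr_ae (Eventually.of_forall fun x => ?_)
      simp only [Complex.real_smul]
      ring)
  have hwL : MemLp w 2 := (memLp_congr_ae hvw).1 hv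
  have hwi : Integrable (fun x => ‖w x‖ ^ 2) := hwL.integrable_norm_pow (by norm_num)
  have hwc : Continuous w := continuous_iff_continuousAt.2 fun x => (hw x).continuousAt
  let χ : ℝ → ℝ := unitBump
  have hχ : IsTest χ := ⟨unitBump.contDiff, unitBump.hasCompactSupport⟩
  obtain ⟨M, hM⟩ := hχ.isTest_deriv.exists_bound
  set K := ∫ x, ‖w x‖ ^ 2 with hK
  have hn : ∀ n : ℕ, (1 / ((n : ℝ) + 1)) ≠ 0 := fun n => by positivity
  set η : ℕ → ℝ → ℝ := fun n x => χ (1 / ((n : ℝ) + 1) * x) with hη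
  have hηt : ∀ n, IsTest (η n) := fun n => hχ.comp_mul (hn n)
  have hηd : ∀ n x, deriv (η n) x = 1 / ((n : ℝ) + 1) * deriv χ (1 / ((n : ℝ) + 1) * x) :=
    fun n x => deriv_comp_mul_left (c := 1 / ((n : ℝ) + 1)) χ x
  -- The cut-off at scale $n+1$ has derivative at most $M/(n+1)$, so the right side of the
  -- Caccioppoli inequality tends to $0$ while the left tends to $\delta\|w\|^2$.
  have hbound : ∀ n, δ * ∫ x, η n x ^ 2 * ‖w x‖ ^ 2 ≤
      ‖a‖ ^ 2 / a.re * ((1 / ((n : ℝ) + 1)) ^ 2 * (M ^ 2 * K)) := by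
    intro n
    refine (caccioppoli ha hW hδ hw hw' (hηt n)).trans ?_
    refine mul_le_mul_of_nonneg_left ?_ (by positivity)
    rw [hK, ← integral_const_mul, ← integral_const_mul]
    refine integral_mono_of_nonneg (Eventually.of_forall fun x => by positivity)
      ((hwi.const_mul _).const_mul _) (Eventually.of_forall fun x => ?_)
    simp only
    rw [hηd, mul_pow, mul_assoc]
    have h1 : deriv χ (1 / ((n : ℝ) + 1) * x) ^ 2 ≤ M ^ 2 :=
      sq_le_sq' (abs_le.1 (hM _)).1 (abs_le.1 (hM _)).2
    gcongr
  have hlim : Tendsto (fun n => δ * ∫ x, η n x ^ 2 * ‖w x‖ ^ 2) atTop (𝓝 (δ * K)) := by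
    refine Tendsto.const_mul _ ?_
    refine tendsto_integral_of_dominated_convergence (fun x => ‖w x‖ ^ 2) ?_ hwi ?_ ?_
    · intro n
      have := (hηt n).continuous
      exact (by fun_prop : Continuous (fun x => η n x ^ 2 * ‖w x‖ ^ 2)).aestronglyMeasurable
    · refine fun n => Eventually.of_forall fun x => ?_
      rw [Real.norm_of_nonneg (by positivity)]
      have h0 : 0 ≤ η n x := unitBump.nonneg
      have h1 : η n x ≤ 1 := unitBump.le_one
      have : η n x ^ 2 ≤ 1 := pow_le_one₀ h0 h1
      nlinarith [sq_nonneg ‖w x‖]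
    · refine Eventually.of_forall fun x => ?_
      refine tendsto_const_nhds.congr' ?_
      have h1 : ∀ᶠ n : ℕ in atTop, |x| ≤ (n : ℝ) := by
        obtain ⟨N, hN⟩ := exists_nat_ge |x|
        filter_upwards [eventually_ge_atTop N] with n hnN
        exact hN.trans (by exact_mod_cast hnN)
      filter_upwards [h1] with n hxn
      have : η n x = 1 := by
        refine unitBump.one_of_mem_closedBall ?_
        rw [Metric.mem_closedBall, dist_zero_right, norm_mul, Real.norm_eq_abs, Real.norm_eq_abs,
          abs_of_pos (by positivity), one_div_mul_eq_div, div_le_iff₀ (by positivity)]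
        show |x| ≤ 1 * ((n : ℝ) + 1)
        linarith
      rw [this]
      simp
  have hlim2 : Tendsto (fun n : ℕ => ‖a‖ ^ 2 / a.re * ((1 / ((n : ℝ) + 1)) ^ 2 * (M ^ 2 * K)))
      atTop (𝓝 0) := by
    have := ((tendsto_one_div_add_atTop_nhds_zero_nat (𝕜 := ℝ)).pow 2).mul_const (M ^ 2 * K)
    have := this.const_mul (‖a‖ ^ 2 / a.re)
    simpa using this
  have hK0 : K = 0 := by
    have h1 : δ * K ≤ 0 := le_of_tendsto_of_tendsto' hlim hlim2 hbound
    have h2 : 0 ≤ K := integral_nonneg fun x => by positivity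
    nlinarith
  have h3 := (integral_eq_zero_iff_of_nonneg (fun x => by positivity) hwi).1 hK0
  filter_upwards [h3, hvw] with x hx1 hx2
  rw [hx2]
  simpa using hx1

/-! ### The pointwise quadratic inequality -/

theorem exists_sq_pow_le {m n : ℕ} (hmn : m < n) {ε : ℝ} (hε : 0 < ε) :
    ∃ C : ℝ, 0 ≤ C ∧ ∀ x : ℝ, (x ^ m) ^ 2 ≤ ε * (x ^ n) ^ 2 + C := by
  -- In terms of $y=x^2$: for $y\ge M$ one extra power of $y$ beats $1/\varepsilon$, and for $y\le
  -- M$ the left side is at most $M^m$.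
  set M := max 1 (1 / ε)
  have hM1 : 1 ≤ M := le_max_left _ _
  refine ⟨M ^ m, by positivity, fun x => ?_⟩
  rw [← pow_mul, ← pow_mul, mul_comm m, mul_comm n, pow_mul, pow_mul]
  have hy : 0 ≤ x ^ 2 := sq_nonneg x
  generalize x ^ 2 = y at hy
  rcases le_total M y with h | h
  · have h1 : 1 ≤ y := hM1.trans h
    have h2 : 1 / ε ≤ y := (le_max_right _ _).trans h
    have h3 : y ^ (m + 1) ≤ y ^ n := pow_le_pow_right₀ h1 hmn
    have h4 : y ^ m ≤ ε * y ^ (m + 1) := by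
      rw [pow_succ, mul_left_comm]
      refine le_mul_of_one_le_right (by positivity) ?_
      rwa [div_le_iff₀' hε] at h2
    have h5 := mul_le_mul_of_nonneg_left h3 hε.le
    have : 0 ≤ M ^ m := by positivity
    linarith
  · have h1 : y ^ m ≤ M ^ m := pow_le_pow_left₀ hy h m
    have : 0 ≤ ε * y ^ n := by positivity
    linarith

/-- The potential `l + b x² + i γ xⁿ`. -/
def pot (b l : ℂ) (γ : ℝ) (n : ℕ) (x : ℝ) : ℂ :=
  l + b * (x : ℂ) ^ 2 + Complex.I * γ * (x : ℂ) ^ n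

theorem continuous_pot (b l : ℂ) (γ : ℝ) (n : ℕ) : Continuous (pot b l γ n) := by
  unfold pot
  fun_prop

theorem contDiff_pot (b l : ℂ) (γ : ℝ) (n : ℕ) : ContDiff ℝ ∞ (pot b l γ n) := by
  have : ContDiff ℝ ∞ (fun x : ℝ => (x : ℂ)) := Complex.ofRealCLM.contDiff
  unfold pot
  fun_prop

theorem pot_re (b l : ℂ) (γ : ℝ) (n : ℕ) (x : ℝ) :
    (pot b l γ n x).re = l.re + b.re * x ^ 2 := by
  have h1 : Complex.I * γ * (x : ℂ) ^ n = Complex.I * ((γ * x ^ n : ℝ) : ℂ) := by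
    push_cast; ring
  rw [pot, h1, Complex.add_re, Complex.add_re, ← Complex.ofReal_pow, Complex.re_mul_ofReal,
    Complex.re_mul_ofReal]
  simp

theorem conj_pot (b l : ℂ) (γ : ℝ) (n : ℕ) (x : ℝ) :
    conj (pot b l γ n x) = pot (conj b) (conj l) (-γ) n x := by
  simp [pot]

theorem norm_sq_leading (a U U2 : ℂ) (γ y : ℝ) :
    ‖-a * U2 + Complex.I * γ * y * U‖ ^ 2 = ‖a‖ ^ 2 * ‖U2‖ ^ 2 + γ ^ 2 * (y ^ 2 * ‖U‖ ^ 2)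
      - 2 * γ * a.im * (y * (conj U2 * U).re) + 2 * γ * a.re * (y * (conj U2 * U).im) := by
  simp only [Complex.sq_norm, Complex.normSq_apply, Complex.add_re, Complex.add_im,
    Complex.mul_re, Complex.mul_im, Complex.neg_re, Complex.neg_im, Complex.I_re, Complex.I_im,
    Complex.ofReal_re, Complex.ofReal_im, Complex.conj_re, Complex.conj_im]
  ring

/-- In the expanded square, the cross term with $\operatorname{Re}(\bar U_2U)$ carries the factor
$\operatorname{Im}a$ and is absorbed, since $|\operatorname{Im}a|/|a|<1$ when
$\operatorname{Re}a>0$. The cross term with $\operatorname{Im}(\bar U_2U)$ has no sign and is kept,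
to be integrated by parts. -/
theorem norm_sq_leading_ge {a : ℂ} (ha : 0 < a.re) (U U2 : ℂ) (γ y : ℝ) :
    (1 - |a.im| / ‖a‖) * (‖a‖ ^ 2 * ‖U2‖ ^ 2 + γ ^ 2 * (y ^ 2 * ‖U‖ ^ 2)) +
      2 * γ * a.re * (y * (conj U2 * U).im) ≤ ‖-a * U2 + Complex.I * γ * y * U‖ ^ 2 := by
  have ha0 : a ≠ 0 := by rintro rfl; simp at ha
  have hapos : 0 < ‖a‖ := norm_pos_iff.2 ha0
  rw [norm_sq_leading]
  have h1 : |(conj U2 * U).re| ≤ ‖U2‖ * ‖U‖ := by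
    refine (Complex.abs_re_le_norm _).trans_eq ?_
    rw [norm_mul, Complex.norm_conj]
  have h2 : 2 * γ * a.im * (y * (conj U2 * U).re) ≤
      2 * |γ| * |a.im| * (|y| * (‖U2‖ * ‖U‖)) := by
    refine (le_abs_self _).trans ?_
    rw [abs_mul, abs_mul, abs_mul, abs_mul, abs_two]
    gcongr
  have h3 : 2 * |γ| * |a.im| * (|y| * (‖U2‖ * ‖U‖)) ≤
      |a.im| / ‖a‖ * (‖a‖ ^ 2 * ‖U2‖ ^ 2 + γ ^ 2 * (y ^ 2 * ‖U‖ ^ 2)) := by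
    have e : |a.im| / ‖a‖ * (‖a‖ ^ 2 * ‖U2‖ ^ 2 + γ ^ 2 * (y ^ 2 * ‖U‖ ^ 2)) -
        2 * |γ| * |a.im| * (|y| * (‖U2‖ * ‖U‖)) =
        |a.im| / ‖a‖ * (‖a‖ * ‖U2‖ - |γ| * (|y| * ‖U‖)) ^ 2 := by
      rw [← sq_abs γ, ← sq_abs y]
      field_simp
      ring
    have : 0 ≤ |a.im| / ‖a‖ * (‖a‖ * ‖U2‖ - |γ| * (|y| * ‖U‖)) ^ 2 := by positivity
    linarith
  linarith

theorem abs_im_div_norm_lt_one {a : ℂ} (ha : 0 < a.re) : |a.im| / ‖a‖ < 1 := by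
  have ha0 : a ≠ 0 := by rintro rfl; simp at ha
  rw [div_lt_one (norm_pos_iff.2 ha0), Complex.abs_im_lt_norm]
  exact ha.ne'

/-- For $U,U_1,U_2=u,u',u''$ the brackets multiplied by $\alpha$ and $\beta$ are the imaginary part
of $(x^{m+1}\bar u'u)'$ and the real part of $(\bar u'u)'$, so they integrate to zero. The first
trades the indefinite cross term for one of lower order in $x$ and in derivatives; the second trades
the resulting $|u'|^2$ for $-\operatorname{Re}(\bar u''u)$. -/
theorem norm_sq_schrodinger_ge {a : ℂ} (ha : 0 < a.re) (b l : ℂ) {γ : ℝ} (hγ : 0 < γ) {m : ℕ}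
    (hm : 2 ≤ m) : ∃ c C α β : ℝ, 0 < c ∧ 0 ≤ C ∧ ∀ (x : ℝ) (U U1 U2 : ℂ),
      c * (‖U2‖ ^ 2 + (x ^ (m + 1)) ^ 2 * ‖U‖ ^ 2) ≤
        ‖-a * U2 + pot b l γ (m + 1) x * U‖ ^ 2 + C * ‖U‖ ^ 2 +
        α * ((m + 1) * x ^ m * (conj U1 * U).im + x ^ (m + 1) * (conj U2 * U).im) +
        β * ((conj U2 * U).re + ‖U1‖ ^ 2) := by
  have ha0 : a ≠ 0 := by rintro rfl; simp at ha
  have hapos : 0 < ‖a‖ := norm_pos_iff.2 ha0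
  set κ := 1 - |a.im| / ‖a‖ with hκdef
  have hκ : 0 < κ := sub_pos.2 (abs_im_div_norm_lt_one ha)
  set c0 := min (κ * ‖a‖ ^ 2) (κ * γ ^ 2) with hc0
  have hc0pos : 0 < c0 := lt_min (by positivity) (by positivity)
  set A := γ * a.re * (m + 1) with hA
  have hApos : 0 < A := by positivity
  -- The two values of $\varepsilon$ make the $x^m$ term and the $bx^2$ term each cost at most
  -- $\tfrac{c_0}{4}Y$, with $Y=x^{2(m+1)}|U|^2$. Another $\tfrac{c_0}{4}|U_2|^2$ is spent in `h7`.
  -- At least half of $c_0$ survives, and the factor $2$ in `h8` leaves $c_0/4$.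
  obtain ⟨C2, hC2, hS⟩ := exists_sq_pow_le (m := m) (n := m + 1) (by omega) (ε := c0 / (4 * A)) (by positivity)
  obtain ⟨C3, hC3, hV⟩ := exists_sq_pow_le (m := 2) (n := m + 1) (by omega)
    (ε := c0 / (16 * (‖b‖ ^ 2 + 1))) (by positivity)
  refine ⟨c0 / 4, (A * C2 + 2 * A ^ 2 / c0 + 4 * ‖b‖ ^ 2 * C3 + 4 * ‖l‖ ^ 2) / 2, -(γ * a.re),
    A / 2, by positivity, by positivity, fun x U U1 U2 => ?_⟩
  have h1 := norm_sq_leading_ge ha U U2 γ (x ^ (m + 1))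
  rw [← hκdef] at h1
  set Y := (x ^ (m + 1)) ^ 2 * ‖U‖ ^ 2 with hY
  have hYpos : 0 ≤ Y := by positivity
  have h2 : c0 * (‖U2‖ ^ 2 + Y) ≤ κ * (‖a‖ ^ 2 * ‖U2‖ ^ 2 + γ ^ 2 * Y) := by
    have e1 : c0 * ‖U2‖ ^ 2 ≤ κ * ‖a‖ ^ 2 * ‖U2‖ ^ 2 := by gcongr; exact min_le_left _ _
    have e2 : c0 * Y ≤ κ * γ ^ 2 * Y := by gcongr; exact min_le_right _ _
    linarith
  set q := (conj U1 * U).im with hq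
  have h3 : |q| ≤ ‖U1‖ * ‖U‖ := by
    refine (Complex.abs_im_le_norm _).trans_eq ?_
    rw [norm_mul, Complex.norm_conj]
  have h4 : 2 * (x ^ m * q) ≤ (x ^ m) ^ 2 * ‖U‖ ^ 2 + ‖U1‖ ^ 2 := by
    have e1 : x ^ m * q ≤ |x ^ m| * (‖U1‖ * ‖U‖) := by
      refine (le_abs_self _).trans ?_
      rw [abs_mul]
      gcongr
    have e2 := sq_nonneg (|x ^ m| * ‖U‖ - ‖U1‖)
    have e3 : (|x ^ m| * ‖U‖ - ‖U1‖) ^ 2 = (x ^ m) ^ 2 * ‖U‖ ^ 2 + ‖U1‖ ^ 2 -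
        2 * (|x ^ m| * (‖U1‖ * ‖U‖)) := by
      rw [← sq_abs (x ^ m)]; ring
    linarith
  have h5 : (x ^ m) ^ 2 * ‖U‖ ^ 2 ≤ c0 / (4 * A) * Y + C2 * ‖U‖ ^ 2 := by
    have := mul_le_mul_of_nonneg_right (hS x) (sq_nonneg ‖U‖)
    rw [hY]
    linarith
  have h6 : -(conj U2 * U).re ≤ ‖U2‖ * ‖U‖ := by
    refine (neg_le_abs _).trans ((Complex.abs_re_le_norm _).trans_eq ?_)
    rw [norm_mul, Complex.norm_conj]
  have h7 : A * (‖U2‖ * ‖U‖) ≤ c0 / 4 * ‖U2‖ ^ 2 + 2 * A ^ 2 / c0 * ‖U‖ ^ 2 := by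
    have e : c0 / 4 * ‖U2‖ ^ 2 + 2 * A ^ 2 / c0 * ‖U‖ ^ 2 - A * (‖U2‖ * ‖U‖) =
        ((c0 * ‖U2‖ - 2 * A * ‖U‖) ^ 2 + 4 * A ^ 2 * ‖U‖ ^ 2) / (4 * c0) := by
      field_simp
      ring
    have : 0 ≤ ((c0 * ‖U2‖ - 2 * A * ‖U‖) ^ 2 + 4 * A ^ 2 * ‖U‖ ^ 2) / (4 * c0) := by positivity
    linarith
  have h8 : ‖-a * U2 + Complex.I * γ * ((x ^ (m + 1) : ℝ) : ℂ) * U‖ ^ 2 ≤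
      2 * ‖-a * U2 + pot b l γ (m + 1) x * U‖ ^ 2 +
        (4 * ‖b‖ ^ 2 * (x ^ 2) ^ 2 + 4 * ‖l‖ ^ 2) * ‖U‖ ^ 2 := by
    set P := -a * U2 + pot b l γ (m + 1) x * U with hP
    have e : -a * U2 + Complex.I * γ * ((x ^ (m + 1) : ℝ) : ℂ) * U =
        P - (l + b * ((x ^ 2 : ℝ) : ℂ)) * U := by
      rw [hP, pot]; push_cast; ring
    have e1 : ‖l + b * ((x ^ 2 : ℝ) : ℂ)‖ ≤ ‖l‖ + ‖b‖ * x ^ 2 := by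
      refine (norm_add_le _ _).trans_eq ?_
      rw [norm_mul, Complex.norm_real, Real.norm_of_nonneg (sq_nonneg x)]
    have e2 : ‖P - (l + b * ((x ^ 2 : ℝ) : ℂ)) * U‖ ≤ ‖P‖ + (‖l‖ + ‖b‖ * x ^ 2) * ‖U‖ := by
      refine (norm_sub_le _ _).trans ?_
      rw [norm_mul]
      gcongr
    rw [e]
    calc ‖P - (l + b * ((x ^ 2 : ℝ) : ℂ)) * U‖ ^ 2
        ≤ (‖P‖ + (‖l‖ + ‖b‖ * x ^ 2) * ‖U‖) ^ 2 := by gcongr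
      _ ≤ 2 * ‖P‖ ^ 2 + 2 * ((‖l‖ + ‖b‖ * x ^ 2) * ‖U‖) ^ 2 := by
        linarith [sq_nonneg (‖P‖ - (‖l‖ + ‖b‖ * x ^ 2) * ‖U‖)]
      _ ≤ _ := by
        have : (‖l‖ + ‖b‖ * x ^ 2) ^ 2 ≤ 2 * ‖b‖ ^ 2 * (x ^ 2) ^ 2 + 2 * ‖l‖ ^ 2 := by
          linarith [sq_nonneg (‖l‖ - ‖b‖ * x ^ 2)]
        have := mul_le_mul_of_nonneg_right this (sq_nonneg ‖U‖)
        rw [mul_pow]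
        linarith
  have h9 : 4 * ‖b‖ ^ 2 * (x ^ 2) ^ 2 * ‖U‖ ^ 2 ≤ c0 / 4 * Y + 4 * ‖b‖ ^ 2 * C3 * ‖U‖ ^ 2 := by
    have e1 := mul_le_mul_of_nonneg_left (mul_le_mul_of_nonneg_right (hV x) (sq_nonneg ‖U‖))
      (by positivity : 0 ≤ 4 * ‖b‖ ^ 2)
    have e2 : 4 * ‖b‖ ^ 2 * (c0 / (16 * (‖b‖ ^ 2 + 1))) ≤ c0 / 4 := by
      rw [← sub_nonneg]
      have : c0 / 4 - 4 * ‖b‖ ^ 2 * (c0 / (16 * (‖b‖ ^ 2 + 1))) = c0 / (4 * (‖b‖ ^ 2 + 1)) := by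
        field_simp
        ring
      rw [this]
      positivity
    have e3 := mul_le_mul_of_nonneg_right e2 hYpos
    have e4 : 4 * ‖b‖ ^ 2 * ((c0 / (16 * (‖b‖ ^ 2 + 1)) * (x ^ (m + 1)) ^ 2 + C3) * ‖U‖ ^ 2) =
        4 * ‖b‖ ^ 2 * (c0 / (16 * (‖b‖ ^ 2 + 1))) * Y + 4 * ‖b‖ ^ 2 * C3 * ‖U‖ ^ 2 := by
      rw [hY]; ring
    linarith
  have h10 : A * (c0 / (4 * A) * Y) = c0 / 4 * Y := by field_simp
  have h11 := mul_le_mul_of_nonneg_left h4 hApos.le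
  have h12 := mul_le_mul_of_nonneg_left h5 hApos.le
  have h13 := mul_le_mul_of_nonneg_left h6 hApos.le
  have h14 : 2 * (A * (x ^ m * q)) = 2 * (γ * a.re) * ((m + 1) * x ^ m * q) := by rw [hA]; ring
  have h15 : A * (c0 / (4 * A) * Y + C2 * ‖U‖ ^ 2) = c0 / 4 * Y + A * C2 * ‖U‖ ^ 2 := by
    rw [mul_add, h10]; ring
  rw [h15] at h12
  have h16 : 0 ≤ c0 * ‖U2‖ ^ 2 := by positivity
  linarith

/-! ### Operators from test functions into $L^2$ -/

theorem contDiff_ofReal : ContDiff ℝ ∞ (fun x : ℝ => (x : ℂ)) :=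
  Complex.ofRealCLM.contDiff

theorem norm_toLp_sq {f : ℝ → ℂ} (hf : MemLp f 2 (volume : Measure ℝ)) :
    ‖hf.toLp f‖ ^ 2 = ∫ x, ‖f x‖ ^ 2 := by
  have h : ((‖hf.toLp f‖ ^ 2 : ℝ) : ℂ) = ((∫ x, ‖f x‖ ^ 2 : ℝ) : ℂ) := by
    have := inner_self_eq_norm_sq_to_K (𝕜 := ℂ) (hf.toLp f)
    rw [Complex.ofReal_pow]
    refine this.symm.trans ?_
    rw [L2.inner_def, ← integral_complex_ofReal]
    refine integral_congr_ae ?_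
    filter_upwards [hf.coeFn_toLp] with x hx
    rw [hx, inner_self_eq_norm_sq_to_K]
    push_cast
    rfl
  exact_mod_cast h

theorem IsTest.memLp {φ : ℝ → ℂ} (h : IsTest φ) : MemLp φ 2 (volume : Measure ℝ) :=
  h.continuous.memLp_of_hasCompactSupport h.hasCompactSupport

theorem IsTest.mul_left {φ W : ℝ → ℂ} (h : IsTest φ) (hW : ContDiff ℝ ∞ W) :
    IsTest (fun x => W x * φ x) :=
  ⟨hW.mul h.contDiff, h.hasCompactSupport.mul_left⟩

/-- The space of complex-valued test functions. -/
def testSpace : Submodule ℂ (ℝ → ℂ) where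
  carrier := {φ | IsTest φ}
  add_mem' h h' := h.add h'
  zero_mem' := ⟨contDiff_const, HasCompactSupport.zero⟩
  smul_mem' c _ h := h.const_smul c

/-- A linear map on test functions which preserves test functions, as a map into `L²`. -/
noncomputable def toL2 (A : (ℝ → ℂ) → ℝ → ℂ) (hA : ∀ φ, IsTest φ → IsTest (A φ))
    (hadd : ∀ φ ψ, IsTest φ → IsTest ψ → A (φ + ψ) = A φ + A ψ)
    (hsmul : ∀ (c : ℂ) φ, IsTest φ → A (c • φ) = c • A φ) : testSpace →ₗ[ℂ] L2 where
  toFun φ := (hA φ φ.2).memLp.toLp (A φ)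
  map_add' φ ψ := by
    rw [← MemLp.toLp_add]
    exact MemLp.toLp_congr _ _ (Eventually.of_forall fun x => congrFun (hadd φ ψ φ.2 ψ.2) x)
  map_smul' c φ := by
    rw [RingHom.id_apply, ← MemLp.toLp_const_smul]
    exact MemLp.toLp_congr _ _ (Eventually.of_forall fun x => congrFun (hsmul c φ φ.2) x)

theorem deriv_add_isTest {φ ψ : ℝ → ℂ} (h : IsTest φ) (h' : IsTest ψ) :
    deriv (φ + ψ) = deriv φ + deriv ψ :=
  funext fun x => ((h.hasDerivAt x).add (h'.hasDerivAt x)).deriv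

theorem deriv_smul_isTest (c : ℂ) {φ : ℝ → ℂ} (h : IsTest φ) :
    deriv (c • φ) = c • deriv φ :=
  funext fun x => ((h.hasDerivAt x).const_smul c).deriv

/-- Multiplication of test functions by a smooth function. -/
noncomputable def mulL2 (W : ℝ → ℂ) (hW : ContDiff ℝ ∞ W) : testSpace →ₗ[ℂ] L2 :=
  toL2 (fun φ x => W x * φ x) (fun _ h => h.mul_left hW)
    (fun φ ψ _ _ => by funext x; simp [mul_add])
    (fun c φ _ => by funext x; simp [mul_left_comm])

/-- The derivative of test functions. -/
noncomputable def derivL2 : testSpace →ₗ[ℂ] L2 :=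
  toL2 deriv (fun _ h => h.isTest_deriv) (fun _ _ h h' => deriv_add_isTest h h')
    (fun c _ h => deriv_smul_isTest c h)

/-- The second derivative of test functions. -/
noncomputable def derivDerivL2 : testSpace →ₗ[ℂ] L2 :=
  toL2 (fun φ => deriv (deriv φ)) (fun _ h => h.isTest_deriv.isTest_deriv)
    (fun _ _ h h' => by
      simp only [deriv_add_isTest h h', deriv_add_isTest h.isTest_deriv h'.isTest_deriv])
    (fun c _ h => by
      simp only [deriv_smul_isTest c h, deriv_smul_isTest c h.isTest_deriv])

/-- The inclusion of test functions. -/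
noncomputable def inclL2 : testSpace →ₗ[ℂ] L2 := mulL2 (fun _ => 1) contDiff_const

theorem coeFn_toL2 {A : (ℝ → ℂ) → ℝ → ℂ} (hA : ∀ φ, IsTest φ → IsTest (A φ))
    (hadd : ∀ φ ψ, IsTest φ → IsTest ψ → A (φ + ψ) = A φ + A ψ)
    (hsmul : ∀ (c : ℂ) φ, IsTest φ → A (c • φ) = c • A φ) (φ : testSpace) :
    ∀ᵐ x, toL2 A hA hadd hsmul φ x = A φ x :=
  MemLp.coeFn_toLp (hA φ φ.2).memLp

theorem coeFn_mulL2 {W : ℝ → ℂ} (hW : ContDiff ℝ ∞ W) (φ : testSpace) :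
    ∀ᵐ x, mulL2 W hW φ x = W x * (φ : ℝ → ℂ) x :=
  coeFn_toL2 _ _ _ φ

theorem coeFn_inclL2 (φ : testSpace) : ∀ᵐ x, inclL2 φ x = (φ : ℝ → ℂ) x := by
  filter_upwards [coeFn_mulL2 (W := fun _ => 1) contDiff_const φ] with x hx
  rw [inclL2, hx, one_mul]

theorem coeFn_derivL2 (φ : testSpace) : ∀ᵐ x, derivL2 φ x = deriv (φ : ℝ → ℂ) x :=
  coeFn_toL2 _ _ _ φ

theorem coeFn_derivDerivL2 (φ : testSpace) :
    ∀ᵐ x, derivDerivL2 φ x = deriv (deriv (φ : ℝ → ℂ)) x :=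
  coeFn_toL2 _ _ _ φ

theorem norm_mulL2_sq {W : ℝ → ℂ} (hW : ContDiff ℝ ∞ W) (φ : testSpace) :
    ‖mulL2 W hW φ‖ ^ 2 = ∫ x, ‖W x * (φ : ℝ → ℂ) x‖ ^ 2 :=
  norm_toLp_sq (φ.2.mul_left hW).memLp

theorem norm_inclL2_sq (φ : testSpace) : ‖inclL2 φ‖ ^ 2 = ∫ x, ‖(φ : ℝ → ℂ) x‖ ^ 2 := by
  rw [inclL2, norm_mulL2_sq]
  simp

theorem norm_derivL2_sq (φ : testSpace) : ‖derivL2 φ‖ ^ 2 = ∫ x, ‖deriv (φ : ℝ → ℂ) x‖ ^ 2 :=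
  norm_toLp_sq φ.2.isTest_deriv.memLp

theorem norm_derivDerivL2_sq (φ : testSpace) :
    ‖derivDerivL2 φ‖ ^ 2 = ∫ x, ‖deriv (deriv (φ : ℝ → ℂ)) x‖ ^ 2 :=
  norm_toLp_sq φ.2.isTest_deriv.isTest_deriv.memLp

/-- The operator `-a u'' + W u` on test functions. -/
noncomputable def schrodingerL2 (a : ℂ) (W : ℝ → ℂ) (hW : ContDiff ℝ ∞ W) : testSpace →ₗ[ℂ] L2 :=
  (-a) • derivDerivL2 + mulL2 W hW

theorem coeFn_schrodingerL2 (a : ℂ) {W : ℝ → ℂ} (hW : ContDiff ℝ ∞ W) (φ : testSpace) :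
    ∀ᵐ x, schrodingerL2 a W hW φ x =
      -a * deriv (deriv (φ : ℝ → ℂ)) x + W x * (φ : ℝ → ℂ) x := by
  have e : schrodingerL2 a W hW φ = (-a) • derivDerivL2 φ + mulL2 W hW φ := rfl
  rw [e]
  filter_upwards [Lp.coeFn_add ((-a) • derivDerivL2 φ) (mulL2 W hW φ),
    Lp.coeFn_smul (-a) (derivDerivL2 φ), coeFn_derivDerivL2 φ, coeFn_mulL2 hW φ] with x h1 h2 h3 h4
  rw [h1, Pi.add_apply, h2, Pi.smul_apply, h3, h4, smul_eq_mul]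

theorem norm_L2_sq (f : L2) : ‖f‖ ^ 2 = ∫ x, ‖f x‖ ^ 2 := by
  have := norm_toLp_sq (Lp.memLp f)
  rwa [Lp.toLp_coeFn] at this

theorem norm_schrodingerL2_sq (a : ℂ) {W : ℝ → ℂ} (hW : ContDiff ℝ ∞ W) (φ : testSpace) :
    ‖schrodingerL2 a W hW φ‖ ^ 2 =
      ∫ x, ‖-a * deriv (deriv (φ : ℝ → ℂ)) x + W x * (φ : ℝ → ℂ) x‖ ^ 2 := by
  rw [norm_L2_sq]
  refine integral_congr_ae ?_
  filter_upwards [coeFn_schrodingerL2 a hW φ] with x hx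
  rw [hx]

/-! ### A priori estimates on test functions -/

theorem integral_re_eq_zero_of_hasDerivAt {f f' : ℝ → ℂ}
    (h : ∀ x, HasDerivAt f (f' x) x) (hf : HasCompactSupport f) (hf' : Continuous f') :
    (Integrable fun x => (f' x).re) ∧ (Integrable fun x => (f' x).im) ∧
      ∫ x, (f' x).re = 0 ∧ ∫ x, (f' x).im = 0 := by
  obtain ⟨hi, h0⟩ := integral_eq_zero_of_hasDerivAt_of_hasCompactSupport h hf hf'
  have h1 := integral_re hi
  have h2 := integral_im hi
  simp only [RCLike.re_to_complex, RCLike.im_to_complex] at h1 h2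
  exact ⟨hi.re, hi.im, by rw [h1, h0, Complex.zero_re], by rw [h2, h0, Complex.zero_im]⟩

theorem IsTest.integrable_norm_sq {φ : ℝ → ℂ} (h : IsTest φ) :
    Integrable fun x => ‖φ x‖ ^ 2 :=
  h.memLp.integrable_norm_pow (by norm_num)

/-- The derivative of `u' ū`. -/
theorem IsTest.hasDerivAt_conj_deriv_mul {u : ℝ → ℂ} (hu : IsTest u) (x : ℝ) :
    HasDerivAt (fun x => conj (deriv u x) * u x)
      (conj (deriv (deriv u) x) * u x + conj (deriv u x) * deriv u x) x :=
  (hu.isTest_deriv.hasDerivAt x).star.mul (hu.hasDerivAt x)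

/-- Integrate $\operatorname{Re}(\overline{Lu}\,u)$: the term $i\gamma x^n|u|^2$ is imaginary and
disappears, while $-au''$ gives $\operatorname{Re}a\,|u'|^2$ up to the exact derivative $F$. Young's
inequality with weight $\operatorname{Re}l$ then keeps half of the zeroth-order term. -/
theorem energy_estimate {a b l : ℂ} (hl : 0 < l.re) (γ : ℝ) (n : ℕ) {u : ℝ → ℂ} (hu : IsTest u) :
    l.re / 2 * (∫ x, ‖u x‖ ^ 2) + a.re * (∫ x, ‖deriv u x‖ ^ 2) +
      b.re * (∫ x : ℝ, ‖(x : ℂ) * u x‖ ^ 2) ≤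
    1 / (2 * l.re) * ∫ x, ‖-a * deriv (deriv u) x + pot b l γ n x * u x‖ ^ 2 := by
  have hx : ContDiff ℝ ∞ (fun x : ℝ => (x : ℂ)) := contDiff_ofReal
  have hL : IsTest (fun x => -a * deriv (deriv u) x + pot b l γ n x * u x) :=
    (hu.isTest_deriv.isTest_deriv.mul_left contDiff_const).add
      (hu.mul_left (contDiff_pot b l γ n))
  have c0 := hu.continuous
  have c1 := hu.isTest_deriv.continuous
  have c2 := hu.isTest_deriv.isTest_deriv.continuous
  set F : ℝ → ℂ := fun x => conj a * (conj (deriv (deriv u) x) * u x +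
    conj (deriv u x) * deriv u x) with hF
  obtain ⟨hi, -, h0, -⟩ := integral_re_eq_zero_of_hasDerivAt
    (f := fun x => conj a * (conj (deriv u x) * u x)) (f' := F)
    (fun x => (hu.hasDerivAt_conj_deriv_mul x).const_mul _)
    hu.hasCompactSupport.mul_left.mul_left (by fun_prop)
  have i0 := hu.integrable_norm_sq.const_mul (l.re / 2)
  have i1 := hu.isTest_deriv.integrable_norm_sq.const_mul a.re
  have i2 := (hu.mul_left hx).integrable_norm_sq.const_mul b.re
  have iL := hL.integrable_norm_sq.const_mul (1 / (2 * l.re))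
  have key : ∀ x : ℝ, l.re / 2 * ‖u x‖ ^ 2 + a.re * ‖deriv u x‖ ^ 2 +
      b.re * ‖(x : ℂ) * u x‖ ^ 2 ≤
      1 / (2 * l.re) * ‖-a * deriv (deriv u) x + pot b l γ n x * u x‖ ^ 2 + (F x).re := by
    intro x
    set P := -a * deriv (deriv u) x + pot b l γ n x * u x with hP
    have e1 : (conj P * u x).re + (F x).re =
        (l.re + b.re * x ^ 2) * ‖u x‖ ^ 2 + a.re * ‖deriv u x‖ ^ 2 := by
      have : conj P * u x + F x = conj (pot b l γ n x) * ((‖u x‖ ^ 2 : ℝ) : ℂ) +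
          conj a * ((‖deriv u x‖ ^ 2 : ℝ) : ℂ) := by
        rw [← Complex.normSq_eq_norm_sq, ← Complex.normSq_eq_norm_sq,
          Complex.normSq_eq_conj_mul_self, Complex.normSq_eq_conj_mul_self, hP, hF]
        simp only [map_add, map_mul, map_neg]
        ring
      rw [← Complex.add_re, this, Complex.add_re, Complex.re_mul_ofReal, Complex.re_mul_ofReal,
        Complex.conj_re, Complex.conj_re, pot_re]
    have e2 : (conj P * u x).re ≤ ‖P‖ * ‖u x‖ := by
      refine (Complex.re_le_norm _).trans_eq ?_
      rw [norm_mul, Complex.norm_conj]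
    have e3 : ‖P‖ * ‖u x‖ ≤ 1 / (2 * l.re) * ‖P‖ ^ 2 + l.re / 2 * ‖u x‖ ^ 2 := by
      rw [← sub_nonneg]
      have : 1 / (2 * l.re) * ‖P‖ ^ 2 + l.re / 2 * ‖u x‖ ^ 2 - ‖P‖ * ‖u x‖ =
          (‖P‖ - l.re * ‖u x‖) ^ 2 / (2 * l.re) := by
        field_simp
        ring
      rw [this]
      positivity
    have e4 : ‖(x : ℂ) * u x‖ ^ 2 = x ^ 2 * ‖u x‖ ^ 2 := by
      rw [norm_mul, mul_pow, Complex.norm_real, Real.norm_eq_abs, sq_abs]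
    rw [e4]
    linarith
  have := integral_mono ((i0.add i1).add i2) (iL.add hi) key
  rw [integral_add' iL hi, integral_add' (i0.add i1) i2, integral_add' i0 i1, h0, add_zero] at this
  simpa only [integral_const_mul] using this

/-- The pointwise quadratic inequality, integrated; its two correction terms are exact derivatives
of compactly supported functions. -/
theorem elliptic_estimate {a : ℂ} (ha : 0 < a.re) (b l : ℂ) {γ : ℝ} (hγ : 0 < γ) {m : ℕ}
    (hm : 2 ≤ m) : ∃ c C : ℝ, 0 < c ∧ 0 ≤ C ∧ ∀ u : ℝ → ℂ, IsTest u →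
      c * ((∫ x, ‖deriv (deriv u) x‖ ^ 2) + ∫ x : ℝ, ‖(x : ℂ) ^ (m + 1) * u x‖ ^ 2) ≤
      (∫ x, ‖-a * deriv (deriv u) x + pot b l γ (m + 1) x * u x‖ ^ 2) +
        C * ∫ x, ‖u x‖ ^ 2 := by
  obtain ⟨c, C, α, β, hc, hC, H⟩ := norm_sq_schrodinger_ge ha b l hγ hm
  refine ⟨c, C, hc, hC, fun u hu => ?_⟩
  have hx : ContDiff ℝ ∞ (fun x : ℝ => (x : ℂ)) := contDiff_ofReal
  have hL : IsTest (fun x => -a * deriv (deriv u) x + pot b l γ (m + 1) x * u x) :=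
    (hu.isTest_deriv.isTest_deriv.mul_left contDiff_const).add
      (hu.mul_left (contDiff_pot b l γ (m + 1)))
  have c0 := hu.continuous
  have c1 := hu.isTest_deriv.continuous
  have c2 := hu.isTest_deriv.isTest_deriv.continuous
  set F : ℝ → ℂ := fun x => (((m + 1) * x ^ m : ℝ) : ℂ) * (conj (deriv u x) * u x) +
    ((x ^ (m + 1) : ℝ) : ℂ) * (conj (deriv (deriv u) x) * u x + conj (deriv u x) * deriv u x)
    with hF
  set G : ℝ → ℂ := fun x => conj (deriv (deriv u) x) * u x + conj (deriv u x) * deriv u x with hG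
  have hFd : ∀ x, HasDerivAt (fun x : ℝ => ((x ^ (m + 1) : ℝ) : ℂ) * (conj (deriv u x) * u x))
      (F x) x := by
    intro x
    have h1 : HasDerivAt (fun x : ℝ => ((x ^ (m + 1) : ℝ) : ℂ)) (((m + 1) * x ^ m : ℝ) : ℂ) x := by
      have := (hasDerivAt_pow (m + 1) x).ofReal_comp
      simpa using this
    exact h1.mul (hu.hasDerivAt_conj_deriv_mul x)
  obtain ⟨-, iF, -, hF0⟩ := integral_re_eq_zero_of_hasDerivAt hFd
    hu.hasCompactSupport.mul_left.mul_left (by fun_prop)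
  obtain ⟨iG, -, hG0, -⟩ := integral_re_eq_zero_of_hasDerivAt (f' := G)
    hu.hasDerivAt_conj_deriv_mul hu.hasCompactSupport.mul_left (by fun_prop)
  have i2 := hu.isTest_deriv.isTest_deriv.integrable_norm_sq
  have iY := (hu.mul_left (hx.pow (m + 1))).integrable_norm_sq
  have iL := hL.integrable_norm_sq
  have iu := hu.integrable_norm_sq.const_mul C
  have key : ∀ x : ℝ, c * (‖deriv (deriv u) x‖ ^ 2 + ‖(x : ℂ) ^ (m + 1) * u x‖ ^ 2) ≤
      ‖-a * deriv (deriv u) x + pot b l γ (m + 1) x * u x‖ ^ 2 + C * ‖u x‖ ^ 2 +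
        α * (F x).im + β * (G x).re := by
    intro x
    have h1 := H x (u x) (deriv u x) (deriv (deriv u) x)
    have e0 : conj (deriv u x) * deriv u x = ((‖deriv u x‖ ^ 2 : ℝ) : ℂ) := by
      rw [← Complex.normSq_eq_norm_sq, Complex.normSq_eq_conj_mul_self]
    have e1 : (G x).re = (conj (deriv (deriv u) x) * u x).re + ‖deriv u x‖ ^ 2 := by
      rw [hG]
      simp only
      rw [e0, Complex.add_re, Complex.ofReal_re]
    have e2 : (F x).im = (m + 1) * x ^ m * (conj (deriv u x) * u x).im +
        x ^ (m + 1) * (conj (deriv (deriv u) x) * u x).im := by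
      rw [hF]
      simp only
      rw [e0, Complex.add_im, Complex.im_ofReal_mul, Complex.im_ofReal_mul, Complex.add_im,
        Complex.ofReal_im, add_zero]
    have e3 : ‖(x : ℂ) ^ (m + 1) * u x‖ ^ 2 = (x ^ (m + 1)) ^ 2 * ‖u x‖ ^ 2 := by
      rw [norm_mul, mul_pow, norm_pow, Complex.norm_real, Real.norm_eq_abs, ← abs_pow, sq_abs]
    rw [e1, e2, e3]
    exact h1
  have := integral_mono ((i2.add iY).const_mul c)
    (((iL.add iu).add (iF.const_mul α)).add (iG.const_mul β)) key
  rw [integral_add' ((iL.add iu).add (iF.const_mul α)) (iG.const_mul β),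
    integral_add' (iL.add iu) (iF.const_mul α), integral_add' iL iu, integral_const_mul,
    integral_add' i2 iY] at this
  simpa only [integral_const_mul, hF0, hG0, mul_zero, add_zero] using this

/-- Bounds for test functions by `-a u'' + W u`. -/
theorem exists_bound_schrodingerL2 {a b l : ℂ} (ha : 0 < a.re) (hb : 0 < b.re) (hl : 0 < l.re)
    {γ : ℝ} (hγ : 0 < γ) {m : ℕ} (hm : 2 ≤ m) :
    ∃ K : ℝ, 0 < K ∧ ∀ φ : testSpace,
      ‖inclL2 φ‖ ≤ (l.re)⁻¹ * ‖schrodingerL2 a _ (contDiff_pot b l γ (m + 1)) φ‖ ∧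
      ‖derivL2 φ‖ ≤ K * ‖schrodingerL2 a _ (contDiff_pot b l γ (m + 1)) φ‖ ∧
      ‖mulL2 (fun x => (x : ℂ)) contDiff_ofReal φ‖ ≤
        K * ‖schrodingerL2 a _ (contDiff_pot b l γ (m + 1)) φ‖ ∧
      ‖derivDerivL2 φ‖ ≤ K * ‖schrodingerL2 a _ (contDiff_pot b l γ (m + 1)) φ‖ ∧
      ‖mulL2 (fun x => (x : ℂ) ^ (m + 1)) (contDiff_ofReal.pow (m + 1)) φ‖ ≤
        K * ‖schrodingerL2 a _ (contDiff_pot b l γ (m + 1)) φ‖ := by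
  obtain ⟨c, C, hc, hC, H⟩ := elliptic_estimate ha b l hγ hm
  set K1 := 1 / (2 * l.re) / a.re with hK1
  set K2 := 1 / (2 * l.re) / b.re with hK2
  set K3 := (1 + C * (l.re)⁻¹ ^ 2) / c with hK3
  have k1 : 0 < K1 := by positivity
  have k2 : 0 < K2 := by positivity
  have k3 : 0 < K3 := by positivity
  refine ⟨√(K1 + K2 + K3), by positivity, fun φ => ?_⟩
  have h1 := energy_estimate (a := a) (b := b) hl γ (m + 1) φ.2
  have h2 := H φ φ.2
  rw [← norm_schrodingerL2_sq a (contDiff_pot b l γ (m + 1)) φ, ← norm_inclL2_sq,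
    ← norm_derivL2_sq, ← norm_mulL2_sq contDiff_ofReal] at h1
  rw [← norm_schrodingerL2_sq a (contDiff_pot b l γ (m + 1)) φ, ← norm_inclL2_sq,
    ← norm_derivDerivL2_sq, ← norm_mulL2_sq (contDiff_ofReal.pow (m + 1))] at h2
  set S := ‖schrodingerL2 a _ (contDiff_pot b l γ (m + 1)) φ‖
  set N0 := ‖inclL2 φ‖
  set N1 := ‖derivL2 φ‖
  set N2 := ‖mulL2 (fun x => (x : ℂ)) contDiff_ofReal φ‖
  set N3 := ‖derivDerivL2 φ‖
  set N4 := ‖mulL2 (fun x => (x : ℂ) ^ (m + 1)) (contDiff_ofReal.pow (m + 1)) φ‖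
  have hS : 0 ≤ S := norm_nonneg _
  have p1 : 0 ≤ a.re * N1 ^ 2 := by positivity
  have p2 : 0 ≤ b.re * N2 ^ 2 := by positivity
  have p0 : 0 ≤ l.re / 2 * N0 ^ 2 := by positivity
  -- The half kept by Young's inequality yields the sharp constant $1/\operatorname{Re}l$, on which
  -- the resolvent bound depends.
  have q0 : N0 ^ 2 ≤ ((l.re)⁻¹ * S) ^ 2 := by
    have : l.re / 2 * N0 ^ 2 ≤ 1 / (2 * l.re) * S ^ 2 := by linarith
    have := mul_le_mul_of_nonneg_left this (by positivity : 0 ≤ 2 / l.re)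
    calc N0 ^ 2 = 2 / l.re * (l.re / 2 * N0 ^ 2) := by field_simp
      _ ≤ 2 / l.re * (1 / (2 * l.re) * S ^ 2) := this
      _ = _ := by field_simp
  have aux : ∀ {N k : ℝ}, 0 ≤ k → k ≤ K1 + K2 + K3 → N ^ 2 ≤ k * S ^ 2 →
      N ≤ √(K1 + K2 + K3) * S := by
    intro N k hk hk' hN
    refine le_of_sq_le_sq ?_ (by positivity)
    rw [mul_pow, Real.sq_sqrt (by positivity)]
    exact hN.trans (by gcongr)
  have q3 : N3 ^ 2 + N4 ^ 2 ≤ K3 * S ^ 2 := by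
    rw [hK3, div_mul_eq_mul_div, le_div_iff₀' hc]
    have := mul_le_mul_of_nonneg_left q0 hC
    rw [mul_pow] at this
    linarith
  refine ⟨le_of_sq_le_sq q0 (by positivity), aux k1.le (by linarith) ?_, aux k2.le (by linarith) ?_,
    aux k3.le (by linarith) ?_, aux k3.le (by linarith) ?_⟩
  · rw [hK1, div_mul_eq_mul_div, le_div_iff₀' ha]
    linarith
  · rw [hK2, div_mul_eq_mul_div, le_div_iff₀' hb]
    linarith
  · linarith [sq_nonneg N4]
  · linarith [sq_nonneg N3]

/-! ### Approximation by step functions -/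

theorem sq_intervalIntegral_le {g : ℝ → ℝ} (hg : Continuous g) {a b : ℝ} (hab : a ≤ b) :
    (∫ x in a..b, g x) ^ 2 ≤ (b - a) * ∫ x in a..b, g x ^ 2 := by
  rcases hab.eq_or_lt with rfl | hlt
  · simp
  set A := ∫ x in a..b, g x with hA
  set B := ∫ x in a..b, g x ^ 2 with hB
  have hL : 0 < b - a := sub_pos.2 hlt
  -- Cauchy–Schwarz in the form of the nonnegativity of a variance.
  have h0 : 0 ≤ ∫ x in a..b, ((b - a) * g x - A) ^ 2 :=
    intervalIntegral.integral_nonneg hab fun x _ => sq_nonneg _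
  have e : ∫ x in a..b, ((b - a) * g x - A) ^ 2 = (b - a) * ((b - a) * B - A ^ 2) := by
    have i1 : IntervalIntegrable (fun x => (b - a) ^ 2 * g x ^ 2) volume a b :=
      (by fun_prop : Continuous (fun x => (b - a) ^ 2 * g x ^ 2)).intervalIntegrable _ _
    have i2 : IntervalIntegrable (fun x => (-2 * (b - a) * A) * g x) volume a b :=
      (by fun_prop : Continuous (fun x => (-2 * (b - a) * A) * g x)).intervalIntegrable _ _
    have i3 : IntervalIntegrable (fun _ => A ^ 2) volume a b := intervalIntegrable_const
    have : ∀ x, ((b - a) * g x - A) ^ 2 =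
        (b - a) ^ 2 * g x ^ 2 + (-2 * (b - a) * A) * g x + A ^ 2 := fun x => by ring
    simp only [this]
    rw [intervalIntegral.integral_add (i1.add i2) i3, intervalIntegral.integral_add i1 i2,
      intervalIntegral.integral_const_mul, intervalIntegral.integral_const_mul,
      intervalIntegral.integral_const, ← hA, ← hB, smul_eq_mul]
    ring
  rw [e] at h0
  have := nonneg_of_mul_nonneg_right h0 hL
  linarith

/-- A Poincaré inequality on one cell: $u(x)-u(a)$ is the integral of $u'$, to which Cauchy–Schwarz
applies. -/
theorem integral_norm_sub_left_sq_le {u u' : ℝ → ℂ} (hu : ∀ x, HasDerivAt u (u' x) x)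
    (hu' : Continuous u') {a b : ℝ} (hab : a ≤ b) :
    ∫ x in a..b, ‖u x - u a‖ ^ 2 ≤ (b - a) ^ 2 * ∫ x in a..b, ‖u' x‖ ^ 2 := by
  have huc : Continuous u := continuous_iff_continuousAt.2 fun x => (hu x).continuousAt
  have hpt : ∀ x ∈ Set.Icc a b, ‖u x - u a‖ ^ 2 ≤ (b - a) * ∫ x in a..b, ‖u' x‖ ^ 2 := by
    intro x hx
    have e : u x - u a = ∫ t in a..x, u' t :=
      (intervalIntegral.integral_eq_sub_of_hasDerivAt (fun t _ => hu t)
        (hu'.intervalIntegrable _ _)).symm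
    have h1 : ‖u x - u a‖ ≤ ∫ t in a..x, ‖u' t‖ := by
      rw [e]
      exact intervalIntegral.norm_integral_le_integral_norm hx.1
    calc ‖u x - u a‖ ^ 2 ≤ (∫ t in a..x, ‖u' t‖) ^ 2 := by gcongr
      _ ≤ (x - a) * ∫ t in a..x, ‖u' t‖ ^ 2 := sq_intervalIntegral_le hu'.norm hx.1
      _ ≤ (b - a) * ∫ t in a..b, ‖u' t‖ ^ 2 := by
        refine mul_le_mul (by linarith [hx.2]) ?_
          (intervalIntegral.integral_nonneg hx.1 fun t _ => by positivity) (by linarith)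
        exact intervalIntegral.integral_mono_interval le_rfl hx.1 hx.2
          (Eventually.of_forall fun t => by positivity) ((hu'.norm.pow 2).intervalIntegrable _ _)
  calc ∫ x in a..b, ‖u x - u a‖ ^ 2
      ≤ ∫ _ in a..b, (b - a) * ∫ x in a..b, ‖u' x‖ ^ 2 :=
        intervalIntegral.integral_mono_on hab
          ((by fun_prop : Continuous fun x => ‖u x - u a‖ ^ 2).intervalIntegrable _ _)
          intervalIntegrable_const hpt
    _ = _ := by rw [intervalIntegral.integral_const, smul_eq_mul]; ring

/-- The step function with value `u (t j)` on `(t j, t (j + 1)]` for `j < J`. -/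
noncomputable def stepFun (t : ℕ → ℝ) (J : ℕ) (u : ℝ → ℂ) (x : ℝ) : ℂ :=
  ∑ j ∈ Finset.range J, (Set.Ioc (t j) (t (j + 1))).indicator (fun _ => u (t j)) x

theorem stepFun_of_mem {t : ℕ → ℝ} (ht : Monotone t) {J j : ℕ} (hj : j < J) (u : ℝ → ℂ) {x : ℝ}
    (hx : x ∈ Set.Ioc (t j) (t (j + 1))) : stepFun t J u x = u (t j) := by
  rw [stepFun, Finset.sum_eq_single j, Set.indicator_of_mem hx]
  · intro i _ hij
    refine Set.indicator_of_notMem (fun hxi => ?_) _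
    exact Set.disjoint_left.1 (ht.pairwise_disjoint_on_Ioc_succ hij) hxi hx
  · intro h
    exact absurd (Finset.mem_range.2 hj) h

theorem stepFun_of_notMem {t : ℕ → ℝ} (ht : Monotone t) {J : ℕ} (u : ℝ → ℂ) {x : ℝ}
    (hx : x ∉ Set.Ioc (t 0) (t J)) : stepFun t J u x = 0 := by
  refine Finset.sum_eq_zero fun j hj => Set.indicator_of_notMem (fun h => hx ?_) _
  exact ⟨(ht (Nat.zero_le j)).trans_lt h.1, h.2.trans (ht (Finset.mem_range.1 hj))⟩

theorem memLp_stepFun (t : ℕ → ℝ) (J : ℕ) (u : ℝ → ℂ) :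
    MemLp (stepFun t J u) 2 (volume : Measure ℝ) := by
  unfold stepFun
  exact memLp_finsetSum _ fun j _ => memLp_indicator_const 2 measurableSet_Ioc _ (Or.inr (by simp))

/-- The span of the indicator functions of the cells `(t j, t (j + 1)]`, `j < J`. -/
noncomputable def stepSpace (t : ℕ → ℝ) (J : ℕ) : Submodule ℂ L2 :=
  Submodule.span ℂ ((fun j => indicatorConstLp 2 (measurableSet_Ioc (a := t j) (b := t (j + 1)))
    (by simp) (1 : ℂ)) '' (Finset.range J : Set ℕ))

instance (t : ℕ → ℝ) (J : ℕ) : FiniteDimensional ℂ (stepSpace t J) :=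
  FiniteDimensional.span_of_finite ℂ ((Finset.finite_toSet _).image _)

theorem toLp_stepFun_mem (t : ℕ → ℝ) (J : ℕ) (u : ℝ → ℂ) :
    (memLp_stepFun t J u).toLp _ ∈ stepSpace t J := by
  have e : (memLp_stepFun t J u).toLp _ = ∑ j ∈ Finset.range J, u (t j) •
      (indicatorConstLp 2 (measurableSet_Ioc (a := t j) (b := t (j + 1))) (by simp) (1 : ℂ) : L2) := by
    apply Lp.ext
    refine (memLp_stepFun t J u).coeFn_toLp.trans ?_
    have h1 : ∀ᵐ x, ∀ j, (u (t j) • (indicatorConstLp 2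
        (measurableSet_Ioc (a := t j) (b := t (j + 1))) (by simp) (1 : ℂ) : L2)) x =
        (Set.Ioc (t j) (t (j + 1))).indicator (fun _ => u (t j)) x := by
      rw [ae_all_iff]
      intro j
      filter_upwards [Lp.coeFn_smul (u (t j)) (indicatorConstLp 2
        (measurableSet_Ioc (a := t j) (b := t (j + 1))) (by simp) (1 : ℂ) : L2),
        indicatorConstLp_coeFn (p := 2) (hs := measurableSet_Ioc (a := t j) (b := t (j + 1)))
          (hμs := by simp) (c := (1 : ℂ)) (μ := (volume : Measure ℝ))] with x hx1 hx2
      rw [hx1, Pi.smul_apply, hx2]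
      by_cases hx : x ∈ Set.Ioc (t j) (t (j + 1)) <;> simp [hx]
    filter_upwards [h1, Lp.coeFn_finsetSum (Finset.range J) (fun j => u (t j) •
      (indicatorConstLp 2 (measurableSet_Ioc (a := t j) (b := t (j + 1))) (by simp) (1 : ℂ) : L2))]
      with x hx1 hx2
    rw [hx2, stepFun, Finset.sum_apply]
    exact Finset.sum_congr rfl fun j _ => (hx1 j).symm
  rw [e]
  exact Submodule.sum_mem _ fun j hj => Submodule.smul_mem _ _
    (Submodule.subset_span ⟨j, Finset.mem_coe.2 hj, rfl⟩)

/-- The $2N^2$ cells of length $1/N$ fill $(-N,N]$. On each, the Poincaré inequality gains $N^{-2}$;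
outside, the step function is zero and $|u|^2\le N^{-2}|xu|^2$. -/
theorem integral_norm_sub_stepFun_sq_le {u : ℝ → ℂ} (hu : IsTest u) {N : ℕ} (hN : 0 < N) :
    ∫ x, ‖u x - stepFun (fun j => -(N : ℝ) + j / N) (2 * N ^ 2) u x‖ ^ 2 ≤
      (1 / (N : ℝ)) ^ 2 * ((∫ x, ‖deriv u x‖ ^ 2) + ∫ x : ℝ, ‖(x : ℂ) * u x‖ ^ 2) := by
  have hN' : (0 : ℝ) < N := Nat.cast_pos.2 hN
  set t : ℕ → ℝ := fun j => -(N : ℝ) + j / N with htdef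
  set J := 2 * N ^ 2 with hJ
  have ht : Monotone t := by
    intro i j hij
    have : (i : ℝ) ≤ j := by exact_mod_cast hij
    simp only [htdef]
    gcongr
  have hstep : ∀ j, t (j + 1) - t j = 1 / N := by
    intro j
    simp only [htdef]
    push_cast
    ring
  have ht0 : t 0 = -N := by simp [htdef]
  have htJ : t J = N := by
    simp only [htdef, hJ]
    push_cast
    field_simp
    ring
  have hd := hu.isTest_deriv.integrable_norm_sq
  have hx := (hu.mul_left contDiff_ofReal).integrable_norm_sq
  have hus : Integrable (fun x => ‖u x - stepFun t J u x‖ ^ 2) :=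
    (hu.memLp.sub (memLp_stepFun t J u)).integrable_norm_pow (by norm_num)
  rw [← integral_add_compl (measurableSet_Ioc (a := t 0) (b := t J)) hus, mul_add]
  refine add_le_add ?_ ?_
  · rw [← intervalIntegral.integral_of_le (ht (Nat.zero_le J)),
      ← intervalIntegral.sum_integral_adjacent_intervals (a := t)
        (fun j _ => hus.intervalIntegrable)]
    have hcell : ∀ j ∈ Finset.range J, ∫ x in (t j)..(t (j + 1)), ‖u x - stepFun t J u x‖ ^ 2 ≤
        (1 / (N : ℝ)) ^ 2 * ∫ x in (t j)..(t (j + 1)), ‖deriv u x‖ ^ 2 := by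
      intro j hj
      have hle := ht (Nat.le_succ j)
      rw [← hstep j]
      refine le_trans (le_of_eq ?_)
        (integral_norm_sub_left_sq_le hu.hasDerivAt hu.isTest_deriv.continuous hle)
      refine intervalIntegral.integral_congr_ae (Eventually.of_forall fun x hxm => ?_)
      rw [Set.uIoc_of_le hle] at hxm
      rw [stepFun_of_mem ht (Finset.mem_range.1 hj) u hxm]
    refine (Finset.sum_le_sum hcell).trans ?_
    rw [← Finset.mul_sum, intervalIntegral.sum_integral_adjacent_intervals (a := t)
        (fun j _ => hd.intervalIntegrable), intervalIntegral.integral_of_le (ht (Nat.zero_le J))]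
    refine mul_le_mul_of_nonneg_left ?_ (by positivity)
    exact setIntegral_le_integral hd (Eventually.of_forall fun x => by positivity)
  · rw [← integral_const_mul]
    refine le_trans (setIntegral_mono_on hus.integrableOn (hx.const_mul _).integrableOn
      measurableSet_Ioc.compl fun x hxm => ?_) (setIntegral_le_integral (hx.const_mul _)
        (Eventually.of_forall fun x => by positivity))
    rw [stepFun_of_notMem ht u hxm, sub_zero, norm_mul, mul_pow, ← mul_assoc]
    refine le_mul_of_one_le_left (by positivity) ?_
    have h1 : (N : ℝ) ≤ |x| := by
      by_contra hlt
      rw [not_le, abs_lt] at hlt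
      exact hxm ⟨by rw [ht0]; exact hlt.1, by rw [htJ]; exact hlt.2.le⟩
    rw [Complex.norm_real, Real.norm_eq_abs, ← mul_pow]
    refine one_le_pow₀ ?_
    rw [one_div_mul_eq_div, le_div_iff₀ hN', one_mul]
    exact h1

/-- Test functions are approximated by step functions, at a rate controlled by `u'` and `x u`. -/
theorem exists_finiteDimensional_approx {ε : ℝ} (hε : 0 < ε) :
    ∃ M : Submodule ℂ L2, FiniteDimensional ℂ M ∧ ∀ φ : testSpace, ∃ s ∈ M,
      ‖inclL2 φ - s‖ ≤ ε * (‖derivL2 φ‖ + ‖mulL2 (fun x => (x : ℂ)) contDiff_ofReal φ‖) := by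
  obtain ⟨n, hn⟩ := exists_nat_one_div_lt hε
  set N := n + 1
  refine ⟨stepSpace (fun j => -(N : ℝ) + j / N) (2 * N ^ 2), inferInstance, fun φ =>
    ⟨_, toLp_stepFun_mem _ _ (φ : ℝ → ℂ), ?_⟩⟩
  have h1 := integral_norm_sub_stepFun_sq_le φ.2 (N := N) (Nat.succ_pos n)
  have h2 : ‖inclL2 φ - (memLp_stepFun (fun j => -(N : ℝ) + j / N) (2 * N ^ 2)
      (φ : ℝ → ℂ)).toLp _‖ ^ 2 =
      ∫ x, ‖(φ : ℝ → ℂ) x - stepFun (fun j => -(N : ℝ) + j / N) (2 * N ^ 2) φ x‖ ^ 2 := by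
    rw [norm_L2_sq]
    refine integral_congr_ae ?_
    filter_upwards [Lp.coeFn_sub (inclL2 φ) ((memLp_stepFun (fun j => -(N : ℝ) + j / N) (2 * N ^ 2)
      (φ : ℝ → ℂ)).toLp _), coeFn_inclL2 φ, (memLp_stepFun (fun j => -(N : ℝ) + j / N) (2 * N ^ 2)
      (φ : ℝ → ℂ)).coeFn_toLp] with x hx1 hx2 hx3
    rw [hx1, Pi.sub_apply, hx2, hx3]
  rw [← h2, ← norm_derivL2_sq, ← norm_mulL2_sq contDiff_ofReal] at h1
  refine le_of_sq_le_sq (h1.trans ?_) (by positivity)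
  rw [mul_pow]
  have h3 : 1 / (N : ℝ) ≤ ε := by
    have : ((N : ℕ) : ℝ) = (n : ℝ) + 1 := by push_cast [N]; ring
    rw [this]
    exact hn.le
  gcongr
  have := mul_nonneg (norm_nonneg (derivL2 φ))
    (norm_nonneg (mulL2 (fun x => (x : ℂ)) contDiff_ofReal φ))
  linarith [add_sq (‖derivL2 φ‖) (‖mulL2 (fun x => (x : ℂ)) contDiff_ofReal φ‖)]

/-! ### Passage to $L^2$ limits -/

theorem tendsto_integral_mul {ψ : ℝ → ℂ} (hψ : Continuous ψ) (hc : HasCompactSupport ψ)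
    {u : ℕ → L2} {v : L2} (h : Tendsto u atTop (𝓝 v)) :
    Tendsto (fun j => ∫ x, ψ x * u j x) atTop (𝓝 (∫ x, ψ x * v x)) := by
  have hm : MemLp (fun x => conj (ψ x)) 2 (volume : Measure ℝ) :=
    (Complex.continuous_conj.comp hψ).memLp_of_hasCompactSupport
      (hc.comp_left (g := conj) (map_zero _))
  have e : ∀ w : L2, ∫ x, ψ x * w x = inner ℂ (hm.toLp _) w := by
    intro w
    rw [L2.inner_def]
    refine integral_congr_ae ?_
    filter_upwards [hm.coeFn_toLp] with x hx
    rw [hx, RCLike.inner_apply, Complex.conj_conj, mul_comm]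
  simp only [e]
  exact tendsto_const_nhds.inner h

theorem integral_smul_eq_integral_mul (ψ : ℝ → ℝ) (u : ℝ → ℂ) :
    ∫ x, ψ x • u x = ∫ x, (ψ x : ℂ) * u x := by
  simp only [Complex.real_smul]

theorem IsTest.tendsto_integral_smul {ψ : ℝ → ℝ} (hψ : IsTest ψ)
    {u : ℕ → L2} {v : L2} (h : Tendsto u atTop (𝓝 v)) :
    Tendsto (fun j => ∫ x, ψ x • u j x) atTop (𝓝 (∫ x, ψ x • v x)) := by
  simp only [integral_smul_eq_integral_mul]
  exact tendsto_integral_mul hψ.ofReal.continuous hψ.ofReal.hasCompactSupport h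

theorem IsWeakDeriv.of_tendsto {u v : ℕ → L2} {u' v' : L2} (h : ∀ j, IsWeakDeriv (u j) (v j))
    (hu : Tendsto u atTop (𝓝 u')) (hv : Tendsto v atTop (𝓝 v')) : IsWeakDeriv u' v' := by
  intro ψ hψ hc
  have ht : IsTest ψ := ⟨hψ, hc⟩
  refine tendsto_nhds_unique (ht.isTest_deriv.tendsto_integral_smul hu) ?_
  have := (ht.tendsto_integral_smul hv).neg
  refine this.congr fun j => ?_
  exact (h j ψ hψ hc).symm

/-- `Q` may be unbounded, so multiplication by it need not be continuous on $L^2$. Against a test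
function it becomes a bounded weight of compact support, so the identity passes to the limit weakly.
-/
theorem ae_eq_mul_of_tendsto {Q : ℝ → ℂ} (hQ : Continuous Q) {u y : ℕ → L2} {u' y' : L2}
    (h : ∀ j, ∀ᵐ x, y j x = Q x * u j x) (hu : Tendsto u atTop (𝓝 u'))
    (hy : Tendsto y atTop (𝓝 y')) : ∀ᵐ x, y' x = Q x * u' x := by
  refine ae_eq_of_integral_contDiff_smul_eq ((Lp.memLp y').locallyIntegrable (by norm_num))
    (((Lp.memLp u').locallyIntegrable (by norm_num)).continuous_mul hQ) fun ψ hψ hc => ?_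
  have ht : IsTest ψ := ⟨hψ, hc⟩
  refine tendsto_nhds_unique (ht.tendsto_integral_smul hy) ?_
  have h1 := tendsto_integral_mul (ψ := fun x => (ψ x : ℂ) * Q x)
    (ht.ofReal.continuous.mul hQ) ht.ofReal.hasCompactSupport.mul_right hu
  have e : ∫ x, ψ x • (Q x * u' x) = ∫ x, (ψ x : ℂ) * Q x * u' x := by
    simp only [Complex.real_smul, mul_assoc]
  rw [e]
  refine h1.congr fun j => ?_
  refine integral_congr_ae ?_
  filter_upwards [h j] with x hx
  rw [hx, Complex.real_smul, mul_assoc]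

theorem IsTest.integral_deriv_smul {ψ : ℝ → ℝ} (hψ : IsTest ψ) {φ : ℝ → ℂ} (hφ : IsTest φ) :
    ∫ x, deriv ψ x • φ x = -∫ x, ψ x • deriv φ x := by
  have c0 := hψ.continuous
  have c1 := hψ.isTest_deriv.continuous
  have c2 := hφ.continuous
  have c3 := hφ.isTest_deriv.continuous
  have i1 : Integrable (fun x => deriv ψ x • φ x) :=
    hψ.isTest_deriv.integrable_smul c2.locallyIntegrable
  have i2 : Integrable (fun x => ψ x • deriv φ x) := hψ.integrable_smul c3.locallyIntegrable
  have := (integral_eq_zero_of_hasDerivAt_of_hasCompactSupport (f := fun x => ψ x • φ x)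
    (f' := fun x => ψ x • deriv φ x + deriv ψ x • φ x)
    (fun x => (hψ.hasDerivAt x).smul (hφ.hasDerivAt x)) hψ.hasCompactSupport.smul_right
    (by fun_prop)).2
  rw [integral_add i2 i1] at this
  rw [eq_neg_iff_add_eq_zero, add_comm]
  exact this

theorem isWeakDeriv_inclL2 (φ : testSpace) : IsWeakDeriv (inclL2 φ) (derivL2 φ) := by
  intro ψ hψ hc
  have e1 : ∫ x, deriv ψ x • inclL2 φ x = ∫ x, deriv ψ x • (φ : ℝ → ℂ) x := by
    refine integral_congr_ae ?_
    filter_upwards [coeFn_inclL2 φ] with x hx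
    rw [hx]
  have e2 : ∫ x, ψ x • derivL2 φ x = ∫ x, ψ x • deriv (φ : ℝ → ℂ) x := by
    refine integral_congr_ae ?_
    filter_upwards [coeFn_derivL2 φ] with x hx
    rw [hx]
  rw [e1, e2]
  exact IsTest.integral_deriv_smul ⟨hψ, hc⟩ φ.2

theorem isWeakDeriv_derivL2 (φ : testSpace) : IsWeakDeriv (derivL2 φ) (derivDerivL2 φ) := by
  intro ψ hψ hc
  have e1 : ∫ x, deriv ψ x • derivL2 φ x = ∫ x, deriv ψ x • deriv (φ : ℝ → ℂ) x := by
    refine integral_congr_ae ?_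
    filter_upwards [coeFn_derivL2 φ] with x hx
    rw [hx]
  have e2 : ∫ x, ψ x • derivDerivL2 φ x = ∫ x, ψ x • deriv (deriv (φ : ℝ → ℂ)) x := by
    refine integral_congr_ae ?_
    filter_upwards [coeFn_derivDerivL2 φ] with x hx
    rw [hx]
  rw [e1, e2]
  exact IsTest.integral_deriv_smul ⟨hψ, hc⟩ φ.2.isTest_deriv

/-! ### Existence, uniqueness and compactness for the rotated equation -/

/-- `u` belongs to `D(p²) ∩ D(xⁿ)` and `-a u'' + W u = f`, with `W = l + b x² + i γ xⁿ`. -/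
def IsSolution (a b l : ℂ) (γ : ℝ) (n : ℕ) (u f : L2) : Prop :=
  ∃ u₁ u₂ : L2, IsWeakDeriv u u₁ ∧ IsWeakDeriv u₁ u₂ ∧
    MemLp (fun x : ℝ => (x : ℂ) ^ n * u x) 2 volume ∧
    ∀ᵐ x, f x = -a * u₂ x + pot b l γ n x * u x

theorem IsSolution.add {a b l : ℂ} {γ : ℝ} {n : ℕ} {u f v g : L2}
    (h : IsSolution a b l γ n u f) (h' : IsSolution a b l γ n v g) :
    IsSolution a b l γ n (u + v) (f + g) := by
  obtain ⟨u₁, u₂, h1, h2, h3, h4⟩ := h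
  obtain ⟨v₁, v₂, h1', h2', h3', h4'⟩ := h'
  refine ⟨u₁ + v₁, u₂ + v₂, h1.add h1', h2.add h2', ?_, ?_⟩
  · exact (xPowOp n).domain.add_mem h3 h3'
  · filter_upwards [h4, h4', Lp.coeFn_add f g, Lp.coeFn_add u v, Lp.coeFn_add u₂ v₂]
      with x e1 e2 e3 e4 e5
    rw [e3, e4, e5, Pi.add_apply, Pi.add_apply, Pi.add_apply, e1, e2]
    ring

theorem IsSolution.smul {a b l : ℂ} {γ : ℝ} {n : ℕ} {u f : L2} (c : ℂ)
    (h : IsSolution a b l γ n u f) : IsSolution a b l γ n (c • u) (c • f) := by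
  obtain ⟨u₁, u₂, h1, h2, h3, h4⟩ := h
  refine ⟨c • u₁, c • u₂, h1.smul c, h2.smul c, ?_, ?_⟩
  · exact (xPowOp n).domain.smul_mem c h3
  · filter_upwards [h4, Lp.coeFn_smul c f, Lp.coeFn_smul c u, Lp.coeFn_smul c u₂]
      with x e1 e3 e4 e5
    rw [e3, e4, e5, Pi.smul_apply, Pi.smul_apply, Pi.smul_apply, e1, smul_eq_mul, smul_eq_mul,
      smul_eq_mul]
    ring

theorem le_pot_re {b l : ℂ} (hb : 0 < b.re) (γ : ℝ) (n : ℕ) (x : ℝ) :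
    l.re ≤ (pot b l γ n x).re := by
  rw [pot_re]
  have : 0 ≤ b.re * x ^ 2 := by positivity
  linarith

theorem IsSolution.eq_zero {a b l : ℂ} (ha : 0 < a.re) (hb : 0 < b.re) (hl : 0 < l.re)
    {γ : ℝ} {n : ℕ} {u : L2} (h : IsSolution a b l γ n u 0) : u = 0 := by
  obtain ⟨u₁, u₂, h1, h2, -, h4⟩ := h
  have h0 : ∀ᵐ x, u x = 0 := by
    refine weak_solution_ae_eq_zero (Lp.memLp u) ha (continuous_pot b l γ n) hl
      (le_pot_re hb γ n) fun φ hφ => ?_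
    rw [h1 _ hφ.isTest_deriv.contDiff hφ.isTest_deriv.hasCompactSupport,
      h2 _ hφ.contDiff hφ.hasCompactSupport, neg_neg, ← integral_const_mul]
    refine integral_congr_ae ?_
    filter_upwards [h4, Lp.coeFn_zero ℂ 2 (volume : Measure ℝ)] with x hx hx0
    rw [hx0, Pi.zero_apply] at hx
    rw [mul_smul_comm]
    congr 1
    linear_combination hx
  apply Lp.ext
  filter_upwards [h0, Lp.coeFn_zero ℂ 2 (volume : Measure ℝ)] with x hx hx0
  rw [hx, hx0, Pi.zero_apply]

theorem IsSolution.unique {a b l : ℂ} (ha : 0 < a.re) (hb : 0 < b.re) (hl : 0 < l.re)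
    {γ : ℝ} {n : ℕ} {u v f : L2} (h : IsSolution a b l γ n u f)
    (h' : IsSolution a b l γ n v f) : u = v := by
  have := h.add (h'.smul (-1))
  rw [neg_one_smul, neg_one_smul, add_neg_cancel] at this
  have := this.eq_zero ha hb hl
  rwa [← sub_eq_add_neg, sub_eq_zero] at this

/-- The range of `-a u'' + W u` on test functions is dense. -/
theorem dense_range_schrodingerL2 {a b l : ℂ} (ha : 0 < a.re) (hb : 0 < b.re) (hl : 0 < l.re)
    (γ : ℝ) (n : ℕ) :
    DenseRange (schrodingerL2 a (pot b l γ n) (contDiff_pot b l γ n)) := by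
  set A := schrodingerL2 a (pot b l γ n) (contDiff_pot b l γ n)
  have h : (LinearMap.range A).topologicalClosure = ⊤ := by
    rw [Submodule.topologicalClosure_eq_top_iff, Submodule.eq_bot_iff]
    intro v hv
    rw [Submodule.mem_orthogonal] at hv
    have h0 : ∀ᵐ x, v x = 0 := by
      -- Orthogonality to the range is the weak form of the adjoint equation: conjugation preserves
      -- the real parts of $a,b,l$ and flips the sign of $\gamma$.
      refine weak_solution_ae_eq_zero (a := conj a) (W := pot (conj b) (conj l) (-γ) n) (δ := l.re)
        (Lp.memLp v) (by simpa using ha) (continuous_pot _ _ _ _) hl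
        (fun x => by
          have := le_pot_re (b := conj b) (l := conj l) (by simpa using hb) (-γ) n x
          simpa using this) fun φ hφ => ?_
      set ψ : testSpace := ⟨fun x => (φ x : ℂ), hφ.ofReal⟩
      have h1 := hv (A ψ) ⟨ψ, rfl⟩
      have hd : deriv (deriv (ψ : ℝ → ℂ)) = fun x => ((deriv (deriv φ) x : ℝ) : ℂ) := by
        show deriv (deriv fun x => (φ x : ℂ)) = _
        rw [deriv_ofReal_comp hφ.differentiable, deriv_ofReal_comp hφ.isTest_deriv.differentiable]
      have hvl : LocallyIntegrable v := (Lp.memLp v).locallyIntegrable (by norm_num)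
      have i1 : Integrable fun x => conj a * deriv (deriv φ) x • v x :=
        (hφ.isTest_deriv.isTest_deriv.integrable_smul hvl).const_mul _
      have i2 : Integrable fun x => φ x • (pot (conj b) (conj l) (-γ) n x * v x) :=
        hφ.integrable_smul (hvl.continuous_mul (continuous_pot _ _ _ _))
      rw [L2.inner_def] at h1
      have e : ∫ x, inner ℂ (A ψ x) (v x) =
          ∫ x, (φ x • (pot (conj b) (conj l) (-γ) n x * v x) -
            conj a * deriv (deriv φ) x • v x) := by
        refine integral_congr_ae ?_
        filter_upwards [coeFn_schrodingerL2 a (contDiff_pot b l γ n) ψ] with x hx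
        rw [hx, hd, RCLike.inner_apply, ← conj_pot]
        simp only [ψ, map_add, map_mul, map_neg, Complex.conj_ofReal, Complex.real_smul]
        ring
      rw [e, integral_sub i2 i1, sub_eq_zero, integral_const_mul] at h1
      exact h1.symm
    apply Lp.ext
    filter_upwards [h0, Lp.coeFn_zero ℂ 2 (volume : Measure ℝ)] with x hx hx0
    rw [hx, hx0, Pi.zero_apply]
  intro f
  have : f ∈ (LinearMap.range A).topologicalClosure := h ▸ Submodule.mem_top
  exact this

/-- The bound makes the images under `B` Cauchy whenever those under `A` are. It produces limits of
$u,u',u'',x^nu$ along test functions with convergent $Lu$. -/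
theorem exists_tendsto_of_norm_le {V F G : Type*} [AddCommGroup V] [Module ℂ V]
    [NormedAddCommGroup F] [NormedSpace ℂ F] [NormedAddCommGroup G] [NormedSpace ℂ G]
    [CompleteSpace G] (A : V →ₗ[ℂ] F) (B : V →ₗ[ℂ] G) {K : ℝ} (h : ∀ v, ‖B v‖ ≤ K * ‖A v‖)
    {φ : ℕ → V} {f : F} (hφ : Tendsto (fun j => A (φ j)) atTop (𝓝 f)) :
    ∃ g, Tendsto (fun j => B (φ j)) atTop (𝓝 g) := by
  refine cauchySeq_tendsto_of_complete ?_
  have hK : ∀ v, ‖B v‖ ≤ (|K| + 1) * ‖A v‖ := fun v =>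
    (h v).trans (by gcongr; linarith [le_abs_self K])
  rw [Metric.cauchySeq_iff]
  intro ε hε
  obtain ⟨N, hN⟩ := Metric.cauchySeq_iff.1 hφ.cauchySeq (ε / (|K| + 1)) (by positivity)
  refine ⟨N, fun i hi j hj => ?_⟩
  have h1 := hN i hi j hj
  rw [dist_eq_norm, ← map_sub, lt_div_iff₀' (by positivity)] at h1
  rw [dist_eq_norm, ← map_sub]
  exact (hK _).trans_lt h1

/-- Solvability, with approximation by test functions. -/
theorem exists_isSolution {a b l : ℂ} (ha : 0 < a.re) (hb : 0 < b.re) (hl : 0 < l.re)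
    {γ : ℝ} (hγ : 0 < γ) {m : ℕ} (hm : 2 ≤ m) (f : L2) :
    ∃ u : L2, IsSolution a b l γ (m + 1) u f ∧ ∃ φ : ℕ → testSpace,
      Tendsto (fun j => inclL2 (φ j)) atTop (𝓝 u) ∧
      Tendsto (fun j => schrodingerL2 a _ (contDiff_pot b l γ (m + 1)) (φ j)) atTop (𝓝 f) := by
  obtain ⟨K, -, H⟩ := exists_bound_schrodingerL2 ha hb hl hγ hm
  set A := schrodingerL2 a (pot b l γ (m + 1)) (contDiff_pot b l γ (m + 1)) with hA
  obtain ⟨y, hy, hyf⟩ := mem_closure_iff_seq_limit.1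
    (dense_range_schrodingerL2 ha hb hl γ (m + 1) f)
  choose φ hφ using hy
  have hAφ : Tendsto (fun j => A (φ j)) atTop (𝓝 f) := by
    refine hyf.congr fun j => (hφ j).symm
  obtain ⟨u, hu⟩ := exists_tendsto_of_norm_le A inclL2 (fun v => (H v).1) hAφ
  obtain ⟨u₁, hu₁⟩ := exists_tendsto_of_norm_le A derivL2 (fun v => (H v).2.1) hAφ
  obtain ⟨u₂, hu₂⟩ := exists_tendsto_of_norm_le A derivDerivL2 (fun v => (H v).2.2.2.1) hAφ
  obtain ⟨g, hg⟩ := exists_tendsto_of_norm_le A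
    (mulL2 (fun x => (x : ℂ) ^ (m + 1)) (contDiff_ofReal.pow (m + 1)))
    (fun v => (H v).2.2.2.2) hAφ
  refine ⟨u, ⟨u₁, u₂, IsWeakDeriv.of_tendsto (fun j => isWeakDeriv_inclL2 _) hu hu₁,
    IsWeakDeriv.of_tendsto (fun j => isWeakDeriv_derivL2 _) hu₁ hu₂, ?_, ?_⟩, φ, hu, hAφ⟩
  · have h1 := ae_eq_mul_of_tendsto (Q := fun x : ℝ => (x : ℂ) ^ (m + 1)) (by fun_prop)
      (fun j => by
        filter_upwards [coeFn_mulL2 (contDiff_ofReal.pow (m + 1)) (φ j), coeFn_inclL2 (φ j)]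
          with x hx1 hx2
        rw [hx1, hx2]) hu hg
    exact (Lp.memLp g).ae_eq h1
  · have h1 := ae_eq_mul_of_tendsto (continuous_pot b l γ (m + 1))
      (fun j => by
        filter_upwards [coeFn_mulL2 (contDiff_pot b l γ (m + 1)) (φ j), coeFn_inclL2 (φ j)]
          with x hx1 hx2
        rw [hx1, hx2]) hu
      -- The product of the potential with the test functions is $L\varphi_j+a\varphi_j''$, so its
      -- limit is known without a separate bound.
      (y' := f + a • u₂) (by
        have := hAφ.add (hu₂.const_smul a)
        refine this.congr fun j => ?_
        rw [hA, schrodingerL2, LinearMap.add_apply, LinearMap.smul_apply, neg_smul]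
        abel)
    filter_upwards [h1, Lp.coeFn_add f (a • u₂), Lp.coeFn_smul a u₂] with x hx1 hx2 hx3
    rw [hx2, Pi.add_apply, hx3, Pi.smul_apply, smul_eq_mul] at hx1
    linear_combination hx1

/-- Orthogonal projection onto $M$ is the best approximation, so $P_MS$ has finite rank and is
within $\varepsilon$ of $S$ in norm. The slack $\delta$ allows $Sf$ to be replaced first by a nearby
test function. -/
theorem isCompactOperator_of_forall_approx {E F : Type*} [NormedAddCommGroup E] [NormedSpace ℂ E]
    [NormedAddCommGroup F] [InnerProductSpace ℂ F] [CompleteSpace F] (S : E →L[ℂ] F)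
    (h : ∀ ε > 0, ∃ M : Submodule ℂ F, FiniteDimensional ℂ M ∧ ∀ f, ∀ δ > 0, ∃ s ∈ M,
      ‖S f - s‖ ≤ ε * ‖f‖ + δ) : IsCompactOperator S := by
  have hcl : IsClosed {T : E →L[ℂ] F | IsCompactOperator T} := isClosed_setOfPred_isCompactOperator
  have : S ∈ closure {T : E →L[ℂ] F | IsCompactOperator T} := by
    rw [Metric.mem_closure_iff]
    intro ε hε
    obtain ⟨M, hM, H⟩ := h (ε / 2) (by positivity)
    refine ⟨M.starProjection.comp S, ?_, ?_⟩
    · have hP : IsCompactOperator (M.orthogonalProjectionOnto) := by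
        have : IsCompactOperator (ContinuousLinearMap.id ℂ M) := by
          exact isCompactOperator_id_iff_finiteDimensional.2 hM
        exact this.comp_clm M.orthogonalProjectionOnto
      exact (hP.clm_comp M.subtypeL).comp_clm S
    · rw [dist_eq_norm]
      refine lt_of_le_of_lt (ContinuousLinearMap.opNorm_le_bound _ (by positivity) fun f => ?_)
        (half_lt_self hε)
      refine le_of_forall_pos_le_add fun δ hδ => ?_
      obtain ⟨s, hs, hsf⟩ := H f δ hδ
      refine le_trans ?_ hsf
      have h1 := M.starProjection_minimal (S f)
      have h2 : ⨅ x : M, ‖S f - x‖ ≤ ‖S f - s‖ :=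
        ciInf_le ⟨0, by rintro _ ⟨x, rfl⟩; exact norm_nonneg _⟩ (⟨s, hs⟩ : M)
      rw [← h1] at h2
      exact h2
  rw [hcl.closure_eq] at this
  exact this

/-- The solution operator of `-a u'' + W u = f`. -/
theorem exists_solution_operator {a b l : ℂ} (ha : 0 < a.re) (hb : 0 < b.re) (hl : 0 < l.re)
    {γ : ℝ} (hγ : 0 < γ) {m : ℕ} (hm : 2 ≤ m) :
    ∃ S : L2 →L[ℂ] L2, (∀ f, IsSolution a b l γ (m + 1) (S f) f) ∧
      (∀ u f, IsSolution a b l γ (m + 1) u f → S f = u) ∧ ‖S‖ ≤ (l.re)⁻¹ ∧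
      IsCompactOperator S := by
  obtain ⟨K, hK, H⟩ := exists_bound_schrodingerL2 ha hb hl hγ hm
  choose s hs φ hφ hAφ using exists_isSolution ha hb hl hγ hm
  have huniq : ∀ u f, IsSolution a b l γ (m + 1) u f → s f = u := fun u f h =>
    (hs f).unique ha hb hl h
  let S₀ : L2 →ₗ[ℂ] L2 :=
    { toFun := s
      map_add' := fun f g => huniq _ _ ((hs f).add (hs g))
      map_smul' := fun c f => huniq _ _ ((hs f).smul c) }
  have hbound : ∀ f, ‖S₀ f‖ ≤ (l.re)⁻¹ * ‖f‖ := fun f =>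
    le_of_tendsto_of_tendsto' (hφ f).norm ((hAφ f).norm.const_mul _) fun j => (H _).1
  let S : L2 →L[ℂ] L2 := S₀.mkContinuous _ hbound
  refine ⟨S, hs, huniq, S₀.mkContinuous_norm_le (by positivity) hbound, ?_⟩
  refine isCompactOperator_of_forall_approx S fun ε hε => ?_
  obtain ⟨M, hM, hMs⟩ := exists_finiteDimensional_approx (ε := ε / (2 * K)) (by positivity)
  refine ⟨M, hM, fun f δ hδ => ?_⟩
  -- Far along the sequence, the distance from $Sf$ to the test function plus
  -- $\varepsilon\|L\varphi_j\|$ is below $\varepsilon\|f\|+\delta$; the approximation error of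
  -- $\varphi_j$ is at most that second term.
  have h1 : Tendsto (fun j => ‖S f - inclL2 (φ f j)‖ +
      ε * ‖schrodingerL2 a _ (contDiff_pot b l γ (m + 1)) (φ f j)‖) atTop
      (𝓝 (‖S f - S f‖ + ε * ‖f‖)) :=
    (tendsto_const_nhds.sub (hφ f)).norm.add ((hAφ f).norm.const_mul ε)
  rw [sub_self, norm_zero, zero_add] at h1
  obtain ⟨j, hj⟩ := (h1.eventually_lt_const (lt_add_of_pos_right _ hδ)).exists
  obtain ⟨t, ht, hts⟩ := hMs (φ f j)
  refine ⟨t, ht, le_trans ?_ hj.le⟩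
  have h2 : ε / (2 * K) * (‖derivL2 (φ f j)‖ + ‖mulL2 (fun x => (x : ℂ)) contDiff_ofReal (φ f j)‖) ≤
      ε * ‖schrodingerL2 a _ (contDiff_pot b l γ (m + 1)) (φ f j)‖ := by
    have := add_le_add (H (φ f j)).2.1 (H (φ f j)).2.2.1
    refine (mul_le_mul_of_nonneg_left this (by positivity)).trans_eq ?_
    field_simp
    ring
  calc ‖S f - t‖ = ‖(S f - inclL2 (φ f j)) + (inclL2 (φ f j) - t)‖ := by congr 1; abel
    _ ≤ _ := (norm_add_le _ _).trans (by gcongr; exact hts.trans h2)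

/-! ### The operator sum and its resolvents -/

theorem pOp_apply {u v : L2} (h : IsWeakDeriv u v) (hu : u ∈ pOp.domain) :
    pOp ⟨u, hu⟩ = (-Complex.I) • v := by
  have h1 : pOp ⟨u, hu⟩ = (-Complex.I) • hu.choose := rfl
  rw [h1, hu.choose_spec.unique h]

theorem pSqOp_mem {u u₁ u₂ : L2} (h : IsWeakDeriv u u₁) (h' : IsWeakDeriv u₁ u₂) :
    u ∈ pSqOp.domain := by
  have hu : u ∈ pOp.domain := ⟨u₁, h⟩
  refine ⟨⟨⟨u, hu⟩, ?_, rfl⟩, hu⟩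
  show pOp ⟨u, hu⟩ ∈ pOp.domain
  rw [pOp_apply h hu]
  exact ⟨_, h'.smul _⟩

theorem exists_of_mem_pSqOp {u : L2} (hu : u ∈ pSqOp.domain) :
    ∃ u₁ u₂ : L2, IsWeakDeriv u u₁ ∧ IsWeakDeriv u₁ u₂ := by
  obtain ⟨⟨y, hy, rfl⟩, -⟩ := hu
  obtain ⟨u₁, h₁⟩ := y.2
  have h2 : pOp y ∈ pOp.domain := hy
  rw [show pOp y = (-Complex.I) • u₁ from pOp_apply h₁ y.2] at h2
  obtain ⟨v, hv⟩ := h2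
  refine ⟨u₁, Complex.I • v, h₁, ?_⟩
  have := hv.smul Complex.I
  rwa [smul_smul, mul_neg, Complex.I_mul_I, neg_neg, one_smul] at this

theorem pSqOp_apply {u u₁ u₂ : L2} (h : IsWeakDeriv u u₁) (h' : IsWeakDeriv u₁ u₂)
    (hu : u ∈ pSqOp.domain) : pSqOp ⟨u, hu⟩ = -u₂ := by
  have hu' : u ∈ pOp.domain := ⟨u₁, h⟩
  have h1 : pOp ⟨u, hu'⟩ ∈ pOp.domain := by
    rw [pOp_apply h hu']
    exact ⟨_, h'.smul _⟩
  have h2 : pSqOp ⟨u, hu⟩ = pOp ⟨pOp ⟨u, hu'⟩, h1⟩ := rfl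
  have h3 : IsWeakDeriv (pOp ⟨u, hu'⟩) ((-Complex.I) • u₂) := by
    rw [pOp_apply h hu']
    exact h'.smul _
  rw [h2, pOp_apply h3 h1, smul_smul, neg_mul_neg, Complex.I_mul_I, neg_one_smul]

theorem coeFn_xPowOp {n : ℕ} {u : L2} (hu : u ∈ (xPowOp n).domain) :
    ∀ᵐ x : ℝ, xPowOp n ⟨u, hu⟩ x = (x : ℂ) ^ n * u x :=
  MemLp.coeFn_toLp hu

/-- Since $|x|^m\le1+|x|^n$. The domain of $x^2$ is therefore redundant in that of the operator sum.
-/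
theorem xPowOp_domain_le {m n : ℕ} (hmn : m ≤ n) : (xPowOp n).domain ≤ (xPowOp m).domain := by
  intro u hu
  have h1 : MemLp (fun x : ℝ => (x : ℂ) ^ n * u x) 2 volume := hu
  have h2 : MemLp (fun x : ℝ => ‖u x‖ + ‖(x : ℂ) ^ n * u x‖) 2 volume :=
    (Lp.memLp u).norm.add h1.norm
  refine h2.mono ?_ (Eventually.of_forall fun x => ?_)
  · exact (by fun_prop : Continuous fun x : ℝ => (x : ℂ) ^ m).aestronglyMeasurable.mul
      (Lp.memLp u).1
  · rw [Real.norm_of_nonneg (by positivity), norm_mul, norm_mul, norm_pow, norm_pow,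
      Complex.norm_real]
    have h3 : ‖x‖ ^ m ≤ 1 + ‖x‖ ^ n := by
      rcases le_total ‖x‖ 1 with h | h
      · have := pow_le_one₀ (n := m) (norm_nonneg x) h
        have : 0 ≤ ‖x‖ ^ n := by positivity
        linarith
      · have := pow_le_pow_right₀ h hmn
        linarith
    calc ‖x‖ ^ m * ‖u x‖ ≤ (1 + ‖x‖ ^ n) * ‖u x‖ := by gcongr
      _ = _ := by ring

/-- The operator sum `a p² + b x² + c xⁿ`. -/
noncomputable def anharmonic (a b c : ℂ) (n : ℕ) : L2 →ₗ.[ℂ] L2 :=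
  a • pSqOp + b • xPowOp 2 + c • xPowOp n

theorem anharmonic_domain (a b c : ℂ) {n : ℕ} (hn : 2 ≤ n) :
    (anharmonic a b c n).domain = pSqOp.domain ⊓ (xPowOp n).domain := by
  show (pSqOp.domain ⊓ (xPowOp 2).domain) ⊓ (xPowOp n).domain = _
  rw [inf_assoc, inf_eq_right.2 (xPowOp_domain_le hn)]

theorem anharmonic_apply (a b c : ℂ) (n : ℕ) {u : L2} (hu : u ∈ (anharmonic a b c n).domain) :
    anharmonic a b c n ⟨u, hu⟩ =
      a • pSqOp ⟨u, hu.1.1⟩ + b • xPowOp 2 ⟨u, hu.1.2⟩ + c • xPowOp n ⟨u, hu.2⟩ := rfl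

theorem coeFn_anharmonic (a b c : ℂ) (n : ℕ) {u u₁ u₂ : L2}
    (hu : u ∈ (anharmonic a b c n).domain) (h : IsWeakDeriv u u₁) (h' : IsWeakDeriv u₁ u₂) :
    ∀ᵐ x : ℝ, anharmonic a b c n ⟨u, hu⟩ x =
      -a * u₂ x + b * ((x : ℂ) ^ 2 * u x) + c * ((x : ℂ) ^ n * u x) := by
  rw [anharmonic_apply, pSqOp_apply h h']
  filter_upwards [coeFn_xPowOp hu.1.2, coeFn_xPowOp hu.2,
    Lp.coeFn_add (a • -u₂ + b • xPowOp 2 ⟨u, hu.1.2⟩) (c • xPowOp n ⟨u, hu.2⟩),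
    Lp.coeFn_add (a • -u₂) (b • xPowOp 2 ⟨u, hu.1.2⟩), Lp.coeFn_smul a (-u₂),
    Lp.coeFn_smul b (xPowOp 2 ⟨u, hu.1.2⟩), Lp.coeFn_smul c (xPowOp n ⟨u, hu.2⟩), Lp.coeFn_neg u₂]
    with x h1 h2 h3 h4 h5 h6 h7 h8
  rw [h3, Pi.add_apply, h4, Pi.add_apply, h5, h6, h7, Pi.smul_apply, Pi.smul_apply, Pi.smul_apply,
    h1, h2, h8, Pi.neg_apply, smul_eq_mul, smul_eq_mul, smul_eq_mul]
  ring

theorem coeFn_smul_add_anharmonic {a b c ζ : ℂ} {γ : ℝ} {n : ℕ} (hc : ζ * c = Complex.I * γ)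
    (l : ℂ) {u u₁ u₂ : L2} (hu : u ∈ (anharmonic a b c n).domain) (h : IsWeakDeriv u u₁)
    (h' : IsWeakDeriv u₁ u₂) :
    ∀ᵐ x : ℝ, (l • u + ζ • anharmonic a b c n ⟨u, hu⟩) x =
      -(ζ * a) * u₂ x + pot (ζ * b) l γ n x * u x := by
  filter_upwards [coeFn_anharmonic a b c n hu h h',
    Lp.coeFn_add (l • u) (ζ • anharmonic a b c n ⟨u, hu⟩), Lp.coeFn_smul l u,
    Lp.coeFn_smul ζ (anharmonic a b c n ⟨u, hu⟩)] with x h1 h2 h3 h4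
  rw [h2, Pi.add_apply, h3, h4, Pi.smul_apply, Pi.smul_apply, h1, smul_eq_mul, smul_eq_mul, pot,
    ← hc]
  ring

theorem isSolution_anharmonic {a b c ζ : ℂ} {γ : ℝ} {n : ℕ} (hc : ζ * c = Complex.I * γ)
    (l : ℂ) (u : (anharmonic a b c n).domain) :
    IsSolution (ζ * a) (ζ * b) l γ n u (l • (u : L2) + ζ • anharmonic a b c n u) := by
  obtain ⟨u, hu⟩ := u
  obtain ⟨u₁, u₂, h₁, h₂⟩ := exists_of_mem_pSqOp hu.1.1
  exact ⟨u₁, u₂, h₁, h₂, hu.2, coeFn_smul_add_anharmonic hc l hu h₁ h₂⟩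

theorem IsSolution.exists_anharmonic {a b c ζ l : ℂ} {γ : ℝ} {n : ℕ} (hn : 2 ≤ n)
    (hc : ζ * c = Complex.I * γ) {u f : L2} (h : IsSolution (ζ * a) (ζ * b) l γ n u f) :
    ∃ hu : u ∈ (anharmonic a b c n).domain, l • u + ζ • anharmonic a b c n ⟨u, hu⟩ = f := by
  obtain ⟨u₁, u₂, h₁, h₂, h3, h4⟩ := h
  have hu : u ∈ (anharmonic a b c n).domain := by
    rw [anharmonic_domain a b c hn]
    exact ⟨pSqOp_mem h₁ h₂, h3⟩
  refine ⟨hu, ?_⟩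
  apply Lp.ext
  filter_upwards [h4, coeFn_smul_add_anharmonic hc l hu h₁ h₂] with x e1 e2
  rw [e1, e2]

/-- With $l=-\zeta z$, the equation $(z-T)u=f$ times $-\zeta$ is $lu+\zeta Tu=-\zeta f$, so
$R=-\zeta S$. -/
theorem exists_isResolventAt_anharmonic {a b c ζ : ℂ} {γ : ℝ} {m : ℕ} (hm : 2 ≤ m)
    (hζ : ‖ζ‖ = 1) (ha : 0 < (ζ * a).re) (hb : 0 < (ζ * b).re) (hγ : 0 < γ)
    (hc : ζ * c = Complex.I * γ) {z : ℂ} (hz : (ζ * z).re < 0) :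
    ∃ R : L2 →L[ℂ] L2, IsResolventAt (anharmonic a b c (m + 1)) z R ∧
      ‖R‖ ≤ (-(ζ * z).re)⁻¹ ∧ IsCompactOperator R := by
  have hζ0 : ζ ≠ 0 := norm_ne_zero_iff.1 (by rw [hζ]; exact one_ne_zero)
  obtain ⟨S, hS, hS', hSn, hSc⟩ := exists_solution_operator ha hb (l := -(ζ * z))
    (by simpa using hz) hγ hm
  have hR : ∀ f, (-ζ • S) f = S (-ζ • f) := fun f => by simp
  refine ⟨-ζ • S, ⟨fun u => ?_, fun f => ?_⟩, ?_, hSc.smul (-ζ)⟩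
  · rw [hR]
    refine hS' _ _ ?_
    convert isSolution_anharmonic hc (-(ζ * z)) u using 1
    rw [smul_sub, smul_smul, neg_mul, neg_smul, neg_smul, sub_neg_eq_add]
  · obtain ⟨hu, he⟩ := (hS (-ζ • f)).exists_anharmonic (by omega) hc
    have hRf := hR f
    refine ⟨hRf ▸ hu, ?_⟩
    have e : anharmonic a b c (m + 1) ⟨(-ζ • S) f, hRf ▸ hu⟩ =
        anharmonic a b c (m + 1) ⟨S (-ζ • f), hu⟩ := by
      congr 1
      exact Subtype.ext hRf
    rw [e, hRf]
    refine smul_right_injective _ (neg_ne_zero.2 hζ0) (Eq.trans ?_ he)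
    simp only [smul_sub, smul_smul, neg_mul, neg_smul, sub_neg_eq_add]
  · rw [norm_smul, norm_neg, hζ, one_mul]
    simpa using hSn

/-- The resolvent bound at $z=-t\zeta^{-1}$ reads $\|(t+\zeta T)u\|\ge t\|u\|$. Squaring leaves
$2t\operatorname{Re}\zeta\langle u,Tu\rangle+\|Tu\|^2\ge0$, and $t\to\infty$ fixes the sign. No
integration by parts on the full domain is needed. -/
theorem re_inner_anharmonic_nonneg {a b c ζ : ℂ} {γ : ℝ} {m : ℕ} (hm : 2 ≤ m)
    (hζ : ‖ζ‖ = 1) (ha : 0 < (ζ * a).re) (hb : 0 < (ζ * b).re) (hγ : 0 < γ)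
    (hc : ζ * c = Complex.I * γ) (u : (anharmonic a b c (m + 1)).domain) :
    0 ≤ (ζ * inner ℂ (u : L2) (anharmonic a b c (m + 1) u)).re := by
  have hζ0 : ζ ≠ 0 := norm_ne_zero_iff.1 (by rw [hζ]; exact one_ne_zero)
  set v := anharmonic a b c (m + 1) u with hv
  have key : ∀ t : ℝ, 0 < t → 0 ≤ 2 * t * (ζ * inner ℂ (u : L2) v).re + ‖v‖ ^ 2 := by
    intro t ht
    have hz : ζ * (-(t : ℂ) * ζ⁻¹) = -(t : ℂ) := by field_simp
    obtain ⟨R, hR, hRn, -⟩ := exists_isResolventAt_anharmonic hm hζ ha hb hγ hc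
      (z := -(t : ℂ) * ζ⁻¹) (by rw [hz]; simpa using ht)
    rw [hz] at hRn
    have h1 := R.le_opNorm ((-(t : ℂ) * ζ⁻¹) • (u : L2) - v)
    rw [hv, hR.1 u, ← hv] at h1
    have e : (-(t : ℂ) * ζ⁻¹) • (u : L2) - v = (-ζ⁻¹) • ((t : ℂ) • (u : L2) + ζ • v) := by
      rw [smul_add, smul_smul, smul_smul, neg_mul, neg_mul, neg_mul, inv_mul_cancel₀ hζ0,
        mul_comm ζ⁻¹, neg_one_smul, sub_eq_add_neg]
    rw [e, norm_smul, norm_neg, norm_inv, hζ, inv_one, one_mul] at h1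
    have h2 : t * ‖(u : L2)‖ ≤ ‖(t : ℂ) • (u : L2) + ζ • v‖ := by
      have h3 : ‖R‖ ≤ t⁻¹ := by simpa using hRn
      have h4 := h1.trans (mul_le_mul_of_nonneg_right h3 (norm_nonneg _))
      rwa [inv_mul_eq_div, le_div_iff₀' ht] at h4
    have h5 := pow_le_pow_left₀ (by positivity) h2 2
    rw [@norm_add_sq ℂ, inner_smul_left, inner_smul_right, norm_smul, norm_smul, hζ, one_mul,
      Complex.norm_real, Real.norm_of_nonneg ht.le, Complex.conj_ofReal, RCLike.re_to_complex,
      Complex.re_ofReal_mul] at h5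
    linarith
  by_contra! hneg
  set q := (ζ * inner ℂ (u : L2) v).re with hq
  -- For this $t$ the left side of `key` would equal $-1$.
  have := key ((‖v‖ ^ 2 + 1) / (-(2 * q))) (div_pos (by positivity) (by linarith))
  have e : 2 * ((‖v‖ ^ 2 + 1) / (-(2 * q))) * q = -(‖v‖ ^ 2 + 1) := by
    have : q ≠ 0 := hneg.ne
    field_simp
  rw [e] at this
  linarith

/-! ### The half-plane and the parameter domain -/

/-- The unimodular factor which rotates the half-plane `-π + α ≤ arg z ≤ α` to `Re z ≥ 0`. -/
noncomputable def rot (α : ℝ) : ℂ := Complex.exp (((Real.pi / 2 - α : ℝ) : ℂ) * Complex.I)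

theorem norm_rot (α : ℝ) : ‖rot α‖ = 1 := Complex.norm_exp_ofReal_mul_I _

theorem rot_mul_exp (α r τ : ℝ) :
    rot α * (r * Complex.exp ((τ : ℂ) * Complex.I)) =
      r * Complex.exp (((Real.pi / 2 - α + τ : ℝ) : ℂ) * Complex.I) := by
  rw [rot, mul_left_comm, ← Complex.exp_add]
  push_cast
  ring_nf

theorem mem_argHalfPlane_iff {α : ℝ} {z : ℂ} : z ∈ argHalfPlane α ↔ 0 ≤ (rot α * z).re := by
  constructor
  · rintro ⟨r, τ, hr, h1, h2, rfl⟩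
    rw [rot_mul_exp, Complex.re_ofReal_mul, Complex.exp_ofReal_mul_I_re]
    exact mul_nonneg hr (Real.cos_nonneg_of_mem_Icc ⟨by linarith, by linarith⟩)
  · intro h
    have h1 := abs_le.1 (Complex.abs_arg_le_pi_div_two_iff.2 h)
    refine ⟨‖rot α * z‖, (rot α * z).arg - (Real.pi / 2 - α), norm_nonneg _, by linarith [h1.1],
      by linarith [h1.2], ?_⟩
    have hne : rot α ≠ 0 := norm_ne_zero_iff.1 (by rw [norm_rot]; exact one_ne_zero)
    refine mul_left_cancel₀ hne ?_
    rw [rot_mul_exp, add_sub_cancel, Complex.norm_mul_exp_arg_mul_I]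

theorem isClosed_argHalfPlane (α : ℝ) : IsClosed (argHalfPlane α) := by
  have : argHalfPlane α = {z | 0 ≤ (rot α * z).re} := Set.ext fun z => mem_argHalfPlane_iff
  rw [this]
  exact isClosed_le continuous_const (by fun_prop)

theorem inv_le_inv_infDist_argHalfPlane {α : ℝ} {z : ℂ} (hz : z ∉ argHalfPlane α) :
    (-(rot α * z).re)⁻¹ ≤ (Metric.infDist z (argHalfPlane α))⁻¹ := by
  have hne : rot α ≠ 0 := norm_ne_zero_iff.1 (by rw [norm_rot]; exact one_ne_zero)
  have hlt : (rot α * z).re < 0 := by rwa [mem_argHalfPlane_iff, not_le] at hz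
  set d := -(rot α * z).re with hd
  -- The foot of the perpendicular from $z$ to the boundary line, at distance $d$.
  set w := z + (rot α)⁻¹ * (d : ℂ) with hw
  have hwmem : w ∈ argHalfPlane α := by
    rw [mem_argHalfPlane_iff, hw, mul_add, mul_inv_cancel_left₀ hne, Complex.add_re,
      Complex.ofReal_re, hd]
    linarith
  have hpos : 0 < Metric.infDist z (argHalfPlane α) :=
    ((isClosed_argHalfPlane α).notMem_iff_infDist_pos ⟨w, hwmem⟩).1 hz
  refine inv_anti₀ hpos ((Metric.infDist_le_dist_of_mem hwmem).trans_eq ?_)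
  rw [dist_eq_norm, hw, sub_add_cancel_left, norm_neg, norm_mul, norm_inv, norm_rot, inv_one,
    one_mul, Complex.norm_real, Real.norm_of_nonneg (by linarith)]

theorem isArg_exp (z : ℂ) : IsArg (Complex.exp z) z.im := by
  refine ⟨Complex.exp_ne_zero z, ?_⟩
  rw [Complex.norm_exp, Complex.ofReal_exp, ← Complex.exp_add, Complex.re_add_im]

theorem IsArg.exists_log {β : ℂ} {s : ℝ} (h : IsArg β s) :
    ∃ w : ℂ, w.im = s ∧ Complex.exp w = β := by
  refine ⟨(Real.log ‖β‖ : ℂ) + s * Complex.I, by simp, ?_⟩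
  rw [Complex.exp_add, ← Complex.ofReal_exp, Real.exp_log (norm_pos_iff.2 h.1)]
  exact h.2.symm

/-- On the logarithmic cover the conditions are linear, so openness and connectedness descend from a
convex open set; no uniqueness of the argument is involved. -/
theorem paramDomain_eq_image (k : ℕ) :
    paramDomain k = Prod.map Complex.exp id ''
      {q : ℂ × ℂ | (q.1.im, q.2.im) ∈ parallelogram k} := by
  ext ⟨β, θ⟩
  constructor
  · rintro ⟨s, hs, hP⟩
    obtain ⟨w, hw, rfl⟩ := hs.exists_log
    exact ⟨(w, θ), by rw [← hw] at hP; exact hP, rfl⟩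
  · rintro ⟨⟨w, θ'⟩, hP, he⟩
    obtain ⟨rfl, rfl⟩ := Prod.mk.inj he
    exact ⟨w.im, isArg_exp w, hP⟩

theorem isOpen_parallelogram (k : ℕ) : IsOpen (parallelogram k) := by
  have h1 : Continuous fun q : ℝ × ℝ => (2 * (k : ℝ) - 1) * q.2 + q.1 := by fun_prop
  have h2 : Continuous fun q : ℝ × ℝ => (2 * (k : ℝ) + 3) * q.2 + q.1 := by fun_prop
  exact (isOpen_lt continuous_const h1).and ((isOpen_lt h1 continuous_const).and
    ((isOpen_lt continuous_const h2).and (isOpen_lt h2 continuous_const)))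

theorem isOpen_paramDomain (k : ℕ) : IsOpen (paramDomain k) := by
  rw [paramDomain_eq_image]
  refine (Complex.isOpenMap_exp.prodMap IsOpenMap.id) _ ?_
  have : Continuous fun q : ℂ × ℂ => (q.1.im, q.2.im) := by fun_prop
  exact (isOpen_parallelogram k).preimage this

theorem convex_parallelogram (k : ℕ) : Convex ℝ (parallelogram k) := by
  rintro ⟨s, t⟩ ⟨h1, h2, h3, h4⟩ ⟨s', t'⟩ ⟨h1', h2', h3', h4'⟩ p q hp hq hpq
  have aux : ∀ {x y : ℝ}, 0 < x → 0 < y → 0 < p * x + q * y := by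
    intro x y hx hy
    rcases hp.eq_or_lt with rfl | hp'
    · have : q = 1 := by linarith
      rw [this]; linarith
    · have := mul_pos hp' hx
      have := mul_nonneg hq hy.le
      linarith
  have hπ : p * Real.pi + q * Real.pi = Real.pi := by rw [← add_mul, hpq, one_mul]
  simp only at h1 h2 h3 h4 h1' h2' h3' h4'
  refine ⟨?_, ?_, ?_, ?_⟩ <;> simp only [Prod.smul_mk, Prod.mk_add_mk, smul_eq_mul]
  · linarith [aux h1 h1']
  · linarith [aux (sub_pos.2 h2) (sub_pos.2 h2')]
  · linarith [aux h3 h3']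
  · linarith [aux (sub_pos.2 h4) (sub_pos.2 h4')]

theorem isConnected_paramDomain (k : ℕ) : IsConnected (paramDomain k) := by
  rw [paramDomain_eq_image]
  let L : ℂ × ℂ →ₗ[ℝ] ℝ × ℝ := LinearMap.prodMap Complex.imLm Complex.imLm
  have hconv : Convex ℝ {q : ℂ × ℂ | (q.1.im, q.2.im) ∈ parallelogram k} :=
    (convex_parallelogram k).linear_preimage L
  refine (hconv.isConnected ⟨((Real.pi / 2 : ℝ) * Complex.I, 0), ?_⟩).image _
    (Continuous.continuousOn (by fun_prop))
  have := Real.pi_pos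
  simp only [parallelogram, Set.mem_ofPred_eq, Complex.im_ofReal_mul, Complex.I_im,
    Complex.zero_im]
  refine ⟨?_, ?_, ?_, ?_⟩ <;> linarith

/-! ### The dilated odd anharmonic oscillator -/

theorem rot_mul_exp_re (α : ℝ) (w : ℂ) :
    (rot α * Complex.exp w).re = Real.exp w.re * Real.sin (α - w.im) := by
  rw [rot, ← Complex.exp_add, Complex.exp_re]
  simp only [Complex.add_re, Complex.add_im, Complex.re_ofReal_mul, Complex.im_ofReal_mul,
    Complex.I_re, Complex.I_im, mul_zero, zero_add, mul_one]
  rw [← Real.cos_pi_div_two_sub]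
  congr 2
  ring

theorem rot_mul_coupling {k : ℕ} {β θ : ℂ} {s : ℝ} (h : IsArg β s) :
    rot (s + (2 * (k : ℝ) + 1) * θ.im) * (β * Complex.exp ((2 * (k : ℂ) + 1) * θ)) =
      Complex.I * ((‖β‖ * Real.exp ((2 * k + 1) * θ.re) : ℝ) : ℂ) := by
  obtain ⟨w, rfl, rfl⟩ := h.exists_log
  have hI : Complex.I = Complex.exp (((Real.pi / 2 : ℝ) : ℂ) * Complex.I) := by
    rw [Complex.ofReal_div, Complex.ofReal_ofNat, Complex.exp_pi_div_two_mul_I]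
  rw [Complex.norm_exp, ← Real.exp_add, Complex.ofReal_exp, ← Complex.exp_add, rot,
    ← Complex.exp_add]
  nth_rewrite 2 [hI]
  rw [← Complex.exp_add]
  congr 1
  apply Complex.ext <;> simp

/-- The real parts are positive multiples of the sines of $(2k+3)t+s$ and $(2k-1)t+s$, which lie in
$(0,\pi)$ by the definition of the parallelogram. -/
theorem rot_mul_coefficients_re_pos {k : ℕ} {s : ℝ} {θ : ℂ} (h : (s, θ.im) ∈ parallelogram k) :
    0 < (rot (s + (2 * (k : ℝ) + 1) * θ.im) * Complex.exp (-2 * θ)).re ∧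
      0 < (rot (s + (2 * (k : ℝ) + 1) * θ.im) * Complex.exp (2 * θ)).re := by
  obtain ⟨h1, h2, h3, h4⟩ := h
  simp only at h1 h2 h3 h4
  rw [rot_mul_exp_re, rot_mul_exp_re]
  refine ⟨mul_pos (Real.exp_pos _) (Real.sin_pos_of_pos_of_lt_pi ?_ ?_),
    mul_pos (Real.exp_pos _) (Real.sin_pos_of_pos_of_lt_pi ?_ ?_)⟩ <;>
  simp only [Complex.mul_im, Complex.neg_re, Complex.neg_im, Complex.re_ofNat, Complex.im_ofNat] <;>
  linarith

theorem exists_isResolventAt_dilatedH {k : ℕ} (hk : 1 ≤ k) {β θ : ℂ} {s : ℝ} (h : IsArg β s)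
    (hP : (s, θ.im) ∈ parallelogram k) {z : ℂ} (hz : z ∉ halfPlanePi k s θ.im) :
    ∃ R : L2 →L[ℂ] L2, IsResolventAt (dilatedH k β θ) z R ∧
      ‖R‖ ≤ (Metric.infDist z (halfPlanePi k s θ.im))⁻¹ ∧ IsCompactOperator R := by
  obtain ⟨ha, hb⟩ := rot_mul_coefficients_re_pos hP
  have hγ : 0 < ‖β‖ * Real.exp ((2 * k + 1) * θ.re) :=
    mul_pos (norm_pos_iff.2 h.1) (Real.exp_pos _)
  have hz' : (rot (s + (2 * (k : ℝ) + 1) * θ.im) * z).re < 0 := by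
    rwa [halfPlanePi, mem_argHalfPlane_iff, not_le] at hz
  obtain ⟨R, hR, hRn, hRc⟩ := exists_isResolventAt_anharmonic (m := 2 * k) (by omega)
    (norm_rot _) ha hb hγ (rot_mul_coupling h) hz'
  exact ⟨R, hR, hRn.trans (inv_le_inv_infDist_argHalfPlane hz), hRc⟩

theorem exists_notMem_halfPlanePi (k : ℕ) (s t : ℝ) : ∃ z, z ∉ halfPlanePi k s t := by
  refine ⟨-(rot (s + (2 * (k : ℝ) + 1) * t))⁻¹, ?_⟩
  have hne : rot (s + (2 * (k : ℝ) + 1) * t) ≠ 0 :=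
    norm_ne_zero_iff.1 (by rw [norm_rot]; exact one_ne_zero)
  rw [halfPlanePi, mem_argHalfPlane_iff, mul_neg, mul_inv_cancel₀ hne]
  simp

theorem opNumericalRange_dilatedH_subset {k : ℕ} (hk : 1 ≤ k) {β θ : ℂ} {s : ℝ} (h : IsArg β s)
    (hP : (s, θ.im) ∈ parallelogram k) :
    opNumericalRange (dilatedH k β θ) ⊆ halfPlanePi k s θ.im := by
  rintro w ⟨u, -, rfl⟩
  obtain ⟨ha, hb⟩ := rot_mul_coefficients_re_pos hP
  have hγ : 0 < ‖β‖ * Real.exp ((2 * k + 1) * θ.re) :=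
    mul_pos (norm_pos_iff.2 h.1) (Real.exp_pos _)
  rw [halfPlanePi, mem_argHalfPlane_iff]
  exact re_inner_anharmonic_nonneg (m := 2 * k) (by omega) (norm_rot _) ha hb hγ
    (rot_mul_coupling h) u

theorem isHolomorphicTypeA_dilatedH {k : ℕ} (hk : 1 ≤ k) :
    IsHolomorphicTypeA (paramDomain k) (domH k) (fun q : ℂ × ℂ => dilatedH k q.1 q.2) := by
  have hres : ∀ q ∈ paramDomain k, ∃ z R, IsResolventAt (dilatedH k q.1 q.2) z R := by
    rintro q ⟨s, hs, hP⟩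
    obtain ⟨z, hz⟩ := exists_notMem_halfPlanePi k s q.2.im
    obtain ⟨R, hR, -⟩ := exists_isResolventAt_dilatedH hk hs hP hz
    exact ⟨z, R, hR⟩
  have hdom : ∀ β θ, (dilatedH k β θ).domain = domH k := fun β θ =>
    anharmonic_domain _ _ _ (by omega)
  refine ⟨isOpen_paramDomain k, isConnected_paramDomain k, fun q hq => ?_, fun q hq => ?_,
    fun q _ => hdom _ _, fun u hu => ?_⟩
  · obtain ⟨z, R, hR⟩ := hres q hq
    exact hR.isClosed
  · obtain ⟨z, R, hR⟩ := hres q hq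
    exact ⟨z, R, hR⟩
  · have hu2 : u ∈ (xPowOp 2).domain := xPowOp_domain_le (by omega) hu.2
    refine ⟨fun q => Complex.exp (-2 * q.2) • pSqOp ⟨u, hu.1⟩ +
      Complex.exp (2 * q.2) • xPowOp 2 ⟨u, hu2⟩ +
      (q.1 * Complex.exp ((2 * (k : ℂ) + 1) * q.2)) • xPowOp (2 * k + 1) ⟨u, hu.2⟩, ?_, ?_⟩
    · exact Differentiable.differentiableOn (by fun_prop)
    · intro q _
      have hq : u ∈ (dilatedH k q.1 q.2).domain := by rw [hdom]; exact hu
      rw [LinearPMap.mem_graph_iff]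
      exact ⟨⟨u, hq⟩, rfl, rfl⟩

end OddAnharmonic

theorem theorem2p5 (k : ℕ) (hk : 1 ≤ k) :
    IsHolomorphicTypeA (paramDomain k) (domH k) (fun q : ℂ × ℂ => dilatedH k q.1 q.2) ∧
    ∀ (β θ : ℂ) (s : ℝ), IsArg β s → (s, θ.im) ∈ parallelogram k →
      HasCompactResolvents (dilatedH k β θ) ∧
      opNumericalRange (dilatedH k β θ) ⊆ halfPlanePi k s θ.im ∧
      HasDiscreteSpectrum (dilatedH k β θ) ∧
      opSpectrum (dilatedH k β θ) ⊆ halfPlanePi k s θ.im ∧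
      ∀ z : ℂ, z ∉ halfPlanePi k s θ.im →
        ∃ R : L2 →L[ℂ] L2, IsResolventAt (dilatedH k β θ) z R ∧
          ‖R‖ ≤ (Metric.infDist z (halfPlanePi k s θ.im))⁻¹ := by
  refine ⟨isHolomorphicTypeA_dilatedH hk, fun β θ s hs hP => ?_⟩
  -- One compact resolvent, at any point outside $\Pi$, gives compactness of all of them and the
  -- discreteness of the spectrum.
  obtain ⟨z₀, hz₀⟩ := exists_notMem_halfPlanePi k s θ.im
  obtain ⟨R₀, hR₀, -, hc⟩ := exists_isResolventAt_dilatedH hk hs hP hz₀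
  have hres : ∀ z ∉ halfPlanePi k s θ.im, ∃ R : L2 →L[ℂ] L2,
      IsResolventAt (dilatedH k β θ) z R ∧
        ‖R‖ ≤ (Metric.infDist z (halfPlanePi k s θ.im))⁻¹ := fun z hz => by
    obtain ⟨R, hR, hRn, -⟩ := exists_isResolventAt_dilatedH hk hs hP hz
    exact ⟨R, hR, hRn⟩
  refine ⟨⟨⟨z₀, R₀, hR₀⟩, fun z R hR => hR₀.isCompactOperator hR hc⟩,
    opNumericalRange_dilatedH_subset hk hs hP, hR₀.hasDiscreteSpectrum hc, fun z hz => ?_, hres⟩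
  by_contra hz'
  obtain ⟨R, hR, -⟩ := hres z hz'
  exact hz ⟨R, hR⟩
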